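/- Let $S^2\subset\mathbb R^3$ be the unit sphere with round metric $\sigma_{AB}$ (used to raise and lower indices), Levi-Civita connection $\nabla$, area form $\epsilon_{AB}$, Laplacian $\Delta$, and let $\tilde X^k$ ($k=1,2,3$) be the restrictions of the coordinate functions. Let $u_1<u_2$. A set of null infinity data on $[u_1,u_2]\times S^2$ is $(m,N_A,C_{AB},N_{AB})$, where $m$ is a function, $N_A$ a one-form and $C_{AB},N_{AB}$ symmetric traceless 2-tensors on $S^2$, all smooth in $(u,x)\in[u_1,u_2]\times S^2$, such that $\partial_uC_{AB}=N_{AB}$ and $$\partial_u m=\tfrac14\nabla^A\nabla^BN_{AB}-\tfrac18N_{AB}N^{AB},$$ $$\partial_uN_A=\nabla_Am-\tfrac14\nabla^D(\nabla_D\nabla^EC_{EA}-\nabla_A\nabla^EC_{ED})+\tfrac14\nabla_A(C_{BE}N^{BE})-\tfrac14\nabla_B(C^{BD}N_{DA})+\tfrac12C_{AB}\nabla_DN^{DB}.$$ The classical energy, linear momentum, angular momentum and center of mass at time $u$ are $$E=\int_{S^2}2m,\qquad P^k=\int_{S^2}2m\tilde X^k,\qquad \tilde J^k=\int_{S^2}\epsilon^{AB}\nabla_B\tilde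 X^k\big[N_A-\tfrac14C_A{}^D\nabla^BC_{DB}\big],$$ $$\tilde C^k=\int_{S^2}\nabla^A\tilde X^k\big[N_A-u\nabla_Am-\tfrac14C_A{}^D\nabla^BC_{DB}-\tfrac1{16}\nabla_A(C_{DE}C^{DE})\big].$$ Smooth functions $c,\underline c$ on $S^2$ are potentials of a 2-tensor $C_{AB}$ if $C_{AB}=\nabla_A\nabla_Bc-\frac12\sigma_{AB}\Delta c+\frac12(\epsilon_A{}^E\nabla_E\nabla_B\underline c+\epsilon_B{}^E\nabla_E\nabla_A\underline c)$. Put $\varepsilon_2(C)_{AB}=\epsilon_A{}^DC_{DB}$. Theorem. For every set of null infinity data $(m,N_A,C_{AB},N_{AB})$ on $[u_1,u_2]\times S^2$ there is exactly one set of null infinity data $(m^*,N^*_A,C^*_{AB},N^*_{AB})$ on $[u_1,u_2]\times S^2$ with $C^*=\varepsilon_2(C)$, $m^*(u_1,\cdot)=m(u_1,\cdot)$ and $N^*_A(u_1,\cdot)=N_A(u_1,\cdot)$. For this dual set, $N^*_{AB}=\varepsilon_2(N)_{AB}$; at each $u\in[u_1,u_2]$, if $(c,\underline c)$ are potentials of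 $C_{AB}$ and $(n,\underline n)$ are potentials of $N_{AB}$, then $(-\underline c,c)$ are potentials of $C^*_{AB}$ and $(-\underline n,n)$ are potentials of $N^*_{AB}$; and the dual set has the same $E$, $P^k$, $\tilde J^k$ and $\tilde C^k$ ($k=1,2,3$) as the original set at every $u\in[u_1,u_2]$. -/

import Mathlib

noncomputable section

namespace NullInfinity

open scoped Manifold ContDiff

/-! ### Calculus on the round unit sphere

The standard round sphere `S²` is realised as the unit sphere of `ℝ³`.  Tensor fields on `S²` are
written in the Cartesian components of `ℝ³`: a one-form `w_A` is a map `x ↦ (w x i)_i` with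
`∑ i, x i * w x i = 0`, and a covariant 2-tensor is a map `x ↦ (T x i j)_{ij}` that vanishes when
either of its slots is filled with the normal vector `x`.  In these components the round metric
`σ` at `x` is the orthogonal projection `δ_ij - x_i x_j` onto the tangent plane, so that raising
and lowering an index of a tangential tensor leaves its components unchanged, and the contraction
of two indices is a plain sum over `Fin 3`. -/

/-- Euclidean 3-space. -/
abbrev E3 : Type := EuclideanSpace ℝ (Fin 3)

/-- The unit sphere, with the smooth structure and topology of Mathlib. -/
abbrev S2 : Type := Metric.sphere (0 : E3) 1

/-- Integration over `S²` with respect to the area measure of the round metric (total mass `4π`). -/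
def sphereIntegral (f : S2 → ℝ) : ℝ :=
  ∫ x, f x ∂((MeasureTheory.volume : MeasureTheory.Measure E3).toSphere)

/-- The extension of a function on `S²` to `ℝ³ \ {0}` that is constant along rays
(with the irrelevant value `0` at the origin). -/
def radialExt (f : S2 → ℝ) (y : E3) : ℝ :=
  open Classical in
  if h : y ≠ 0 then
    f ⟨‖y‖⁻¹ • y, mem_sphere_zero_iff_norm.mpr (norm_smul_inv_norm (𝕜 := ℝ) h)⟩
  else 0

/-- The Cartesian partial derivative `∂_i` at a point of `S²` of the radially constant extension. -/
def partialDeriv (i : Fin 3) (f : S2 → ℝ) (x : S2) : ℝ :=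
  fderiv ℝ (radialExt f) (x : E3) (EuclideanSpace.single i 1)

/-- The round metric `σ_AB`, that is, the projection onto the tangent plane at `x`. -/
def metric (x : S2) (i j : Fin 3) : ℝ :=
  (if i = j then 1 else 0) - (x : E3) i * (x : E3) j

/-- The area form `ε_AB` of the round metric, `ε(v, w) = det (x, v, w)` (outward orientation). -/
def areaForm (x : S2) (i j : Fin 3) : ℝ :=
  Matrix.det (Matrix.of ![fun k => (x : E3) k, Pi.single i 1, Pi.single j 1])

/-- `∇_A f` for a function `f`. -/
def grad (f : S2 → ℝ) (x : S2) (i : Fin 3) : ℝ :=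
  ∑ a, metric x i a * partialDeriv a f x

/-- `∇_A w_B` for a one-form `w` (first index: direction of differentiation): the Levi-Civita
connection of the round metric is the tangential projection of the Euclidean derivative. -/
def covD1 (w : S2 → Fin 3 → ℝ) (x : S2) (i j : Fin 3) : ℝ :=
  ∑ a, ∑ b, metric x i a * metric x j b * partialDeriv a (fun y => w y b) x

/-- `∇_A T_BC` for a 2-tensor `T` (first index: direction of differentiation). -/
def covD2 (T : S2 → Fin 3 → Fin 3 → ℝ) (x : S2) (i j k : Fin 3) : ℝ :=
  ∑ a, ∑ b, ∑ c, metric x i a * metric x j b * metric x k c *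
    partialDeriv a (fun y => T y b c) x

/-- The Hessian `∇_A ∇_B f`. -/
def hess (f : S2 → ℝ) : S2 → Fin 3 → Fin 3 → ℝ := covD1 (grad f)

/-- The Laplacian `Δ f = ∇^A ∇_A f`. -/
def lap (f : S2 → ℝ) (x : S2) : ℝ := ∑ i, hess f x i i

/-- The divergence `∇^A w_A` of a one-form. -/
def div1 (w : S2 → Fin 3 → ℝ) (x : S2) : ℝ := ∑ i, covD1 w x i i

/-- The divergence `∇^B T_BA` of a 2-tensor in its first index. -/
def div2 (T : S2 → Fin 3 → Fin 3 → ℝ) (x : S2) (j : Fin 3) : ℝ := ∑ i, covD2 T x i i j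

/-- The inner product `S_AB T^AB` of two 2-tensors. -/
def inner2 (S T : S2 → Fin 3 → Fin 3 → ℝ) (x : S2) : ℝ := ∑ i, ∑ j, S x i j * T x i j

/-- The standard coordinate function `X^k` of `ℝ³` restricted to `S²`. -/
def coord (k : Fin 3) (x : S2) : ℝ := (x : E3) k

/-- One-forms on `S²`: tangential fields of covectors. -/
def IsOneForm (w : S2 → Fin 3 → ℝ) : Prop :=
  ∀ x : S2, ∑ i, (x : E3) i * w x i = 0

/-- Symmetric traceless (tangential) 2-tensors on `S²`. -/
def IsSymTraceless (T : S2 → Fin 3 → Fin 3 → ℝ) : Prop :=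
  ∀ x : S2, (∀ j, ∑ i, (x : E3) i * T x i j = 0) ∧ (∀ i j, T x i j = T x j i) ∧ ∑ i, T x i i = 0

/-- The duality map `ε₂(C)_AB = ε_A^D C_DB`. -/
def eps2 (T : S2 → Fin 3 → Fin 3 → ℝ) (x : S2) (i j : Fin 3) : ℝ :=
  ∑ d, areaForm x i d * T x d j

/-- The functions `c` and `cb` (smooth) are potentials of the 2-tensor `T`:
`T_AB = ∇_A∇_B c - ½ σ_AB Δc + ½ (ε_A^E ∇_E∇_B cb + ε_B^E ∇_E∇_A cb)`. -/
def IsPotentials (T : S2 → Fin 3 → Fin 3 → ℝ) (c cb : S2 → ℝ) : Prop :=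
  ContMDiff (𝓡 2) 𝓘(ℝ, ℝ) ∞ c ∧ ContMDiff (𝓡 2) 𝓘(ℝ, ℝ) ∞ cb ∧
  ∀ x i j, T x i j = hess c x i j - 1 / 2 * metric x i j * lap c x
    + 1 / 2 * (∑ e, areaForm x i e * hess cb x e j + ∑ e, areaForm x j e * hess cb x e i)

/-! ### Null infinity data -/

/-- Fields on null infinity as functions of the retarded time and of the point of `S²`:
the mass aspect `m`, the angular momentum aspect `N_A`, the shear `C_AB` and the news `N_AB`. -/
structure Fields where
  mass : ℝ → S2 → ℝ
  angMom : ℝ → S2 → Fin 3 → ℝ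
  shear : ℝ → S2 → Fin 3 → Fin 3 → ℝ
  news : ℝ → S2 → Fin 3 → Fin 3 → ℝ

/-- Joint smoothness on `[u₁, u₂] × S²`. -/
def SmoothOn {F : Type*} [NormedAddCommGroup F] [NormedSpace ℝ F] (u₁ u₂ : ℝ)
    (f : ℝ → S2 → F) : Prop :=
  ContMDiffOn (𝓘(ℝ, ℝ).prod (𝓡 2)) 𝓘(ℝ, F) ∞ (fun p : ℝ × S2 => f p.1 p.2)
    (Set.Icc u₁ u₂ ×ˢ Set.univ)

/-- The right-hand side `¼ ∇^A ∇^B N_AB - ⅛ N_AB N^AB` of the evolution equation of `m`. -/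
def massRHS (N : S2 → Fin 3 → Fin 3 → ℝ) (x : S2) : ℝ :=
  1 / 4 * div1 (div2 N) x - 1 / 8 * inner2 N N x

/-- The right-hand side of the evolution equation of the angular momentum aspect,
`∇_A m - ¼ ∇^D (∇_D ∇^E C_EA - ∇_A ∇^E C_ED) + ¼ ∇_A (C_BE N^BE) - ¼ ∇_B (C^BD N_DA)
  + ½ C_AB ∇_D N^DB`. -/
def angMomRHS (m : S2 → ℝ) (C N : S2 → Fin 3 → Fin 3 → ℝ) (x : S2) (i : Fin 3) : ℝ :=
  grad m x i
  - 1 / 4 * div2 (fun y d a => covD1 (div2 C) y d a - covD1 (div2 C) y a d) x i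
  + 1 / 4 * grad (inner2 C N) x i
  - 1 / 4 * div2 (fun y b a => ∑ d, C y b d * N y d a) x i
  + 1 / 2 * ∑ b, C x i b * div2 N x b

/-- Null infinity data on `[u₁, u₂] × S²`: smooth fields of the right tensor types with
`∂_u C_AB = N_AB` that satisfy the evolution equations of the mass aspect and of the angular
momentum aspect (one-sided derivatives in `u` at the end points). -/
structure IsNullInfinityData (u₁ u₂ : ℝ) (D : Fields) : Prop where
  smooth_mass : SmoothOn u₁ u₂ D.mass
  smooth_angMom : SmoothOn u₁ u₂ D.angMom
  smooth_shear : SmoothOn u₁ u₂ D.shear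
  smooth_news : SmoothOn u₁ u₂ D.news
  oneForm_angMom : ∀ u ∈ Set.Icc u₁ u₂, IsOneForm (D.angMom u)
  symTraceless_shear : ∀ u ∈ Set.Icc u₁ u₂, IsSymTraceless (D.shear u)
  symTraceless_news : ∀ u ∈ Set.Icc u₁ u₂, IsSymTraceless (D.news u)
  deriv_shear : ∀ u ∈ Set.Icc u₁ u₂, ∀ x i j,
    HasDerivWithinAt (fun v => D.shear v x i j) (D.news u x i j) (Set.Icc u₁ u₂) u
  deriv_mass : ∀ u ∈ Set.Icc u₁ u₂, ∀ x,
    HasDerivWithinAt (fun v => D.mass v x) (massRHS (D.news u) x) (Set.Icc u₁ u₂) u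
  deriv_angMom : ∀ u ∈ Set.Icc u₁ u₂, ∀ x i,
    HasDerivWithinAt (fun v => D.angMom v x i)
      (angMomRHS (D.mass u) (D.shear u) (D.news u) x i) (Set.Icc u₁ u₂) u

/-- `D'` is the dual of `D` on `[u₁, u₂]`: null infinity data (in particular a solution of
the evolution equations) with shear `ε₂(C)` and with the same mass aspect and angular momentum
aspect as `D` at the initial time `u₁`. -/
structure IsDualData (u₁ u₂ : ℝ) (D D' : Fields) : Prop where
  isData : IsNullInfinityData u₁ u₂ D'
  shear_eq : ∀ u ∈ Set.Icc u₁ u₂, D'.shear u = eps2 (D.shear u)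
  mass_init : D'.mass u₁ = D.mass u₁
  angMom_init : D'.angMom u₁ = D.angMom u₁

/-- Two sets of fields coincide on `[u₁, u₂] × S²`. -/
def AgreeOn (u₁ u₂ : ℝ) (D D' : Fields) : Prop :=
  ∀ u ∈ Set.Icc u₁ u₂, D'.mass u = D.mass u ∧ D'.angMom u = D.angMom u ∧
    D'.shear u = D.shear u ∧ D'.news u = D.news u

/-! ### Classical conserved quantities at retarded time `u` -/

/-- The energy `E = ∫ 2m`. -/
def energy (D : Fields) (u : ℝ) : ℝ := sphereIntegral fun x => 2 * D.mass u x

/-- The linear momentum `P^k = ∫ 2m X^k`. -/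
def linearMomentum (D : Fields) (u : ℝ) (k : Fin 3) : ℝ :=
  sphereIntegral fun x => 2 * D.mass u x * coord k x

/-- The one-form `N_A - ¼ C_A^D ∇^B C_DB`. -/
def correctedAspect (D : Fields) (u : ℝ) (x : S2) (i : Fin 3) : ℝ :=
  D.angMom u x i
    - 1 / 4 * ∑ d, D.shear u x i d * ∑ b, covD2 (D.shear u) x b d b

/-- The classical angular momentum
`J^k = ∫ ε^AB ∇_B X^k [N_A - ¼ C_A^D ∇^B C_DB]`. -/
def angularMomentum (D : Fields) (u : ℝ) (k : Fin 3) : ℝ :=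
  sphereIntegral fun x =>
    ∑ i, (∑ j, areaForm x i j * grad (coord k) x j) * correctedAspect D u x i

/-- The classical center of mass
`C^k = ∫ ∇^A X^k [N_A - u ∇_A m - ¼ C_A^D ∇^B C_DB - (1/16) ∇_A (C_DE C^DE)]`. -/
def centerOfMass (D : Fields) (u : ℝ) (k : Fin 3) : ℝ :=
  sphereIntegral fun x =>
    ∑ i, grad (coord k) x i *
      (correctedAspect D u x i - u * grad (D.mass u) x i
        - 1 / 16 * grad (inner2 (D.shear u) (D.shear u)) x i)

end NullInfinity

end

noncomputable section

namespace NullInfinity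

open scoped Manifold ContDiff Topology
open Set

/-! ### Smooth functions on the sphere and their radially constant extensions -/

/-! On the tangent plane `ε` is rotation by a right angle, an isometry which is parallel. Since `C`
and `N` are symmetric and traceless, every quadratic term of the evolution equations is unchanged
when both tensors are rotated: `inner2 C N`, the product `C_BD N_DA`, and `C_AB ∇_D N_DB`
(`inner2_eps2`, `sum_eps2_mul_rotate`, `cartDiv_eps2`, `angMomQuadratic_eps2`). Only the linear
terms see the duality. With `K = ε₂(C) - C` and `G` its time primitive vanishing at `u₁`, the
changes of `m` and `N_A` are therefore explicit: `massShift` is a quarter of the increment of `div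
div K` since `u₁`, and `angMomShift` is the time integral of its gradient minus a quarter of `div
curl div K`. Adding these shifts gives existence. Uniqueness holds because the system is triangular:
the shear fixes the news, these fix `m`, and all three fix `N_A`.

The quadratic terms of the charges are invariant as well, so the charges change only by integrals of
the shifts against `1`, `X^k`, `∇X^k` and rotation fields. These vanish after integration by parts:
double divergences of symmetric traceless tensors are orthogonal to the modes `ℓ ≤ 1`, and
divergences of antisymmetric curls are handled by `sphereIntegral_cartDivCurlDiv` and
`sphereIntegral_areaForm_cartDivCurlDiv`.

All tensor calculus is reduced to derivations `∂_a` of scalar functions with four rules: `x·∂f = 0`,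
`∂_a x_b = σ_ab`, `[∂_a, ∂_b] = x_a ∂_b - x_b ∂_a`, and `∫ ∂_b f = 2 ∫ x_b f`. Covariant derivatives
of tangential tensors become `∂_a` plus explicit terms in `x`, and the identities become polynomial
algebra. -/

instance finrank_E3 : Fact (Module.finrank ℝ E3 = 2 + 1) := ⟨by simp⟩

/-- The retraction `y ↦ y / ‖y‖` of `ℝ³ \ {0}` onto the sphere. -/
def retraction (y : E3) : S2 :=
  open Classical in
  if h : y ≠ 0 then ⟨‖y‖⁻¹ • y, mem_sphere_zero_iff_norm.mpr (norm_smul_inv_norm (𝕜 := ℝ) h)⟩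
  -- An arbitrary point: the retraction is only used away from the origin.
  else ⟨EuclideanSpace.single 0 1, by simp⟩

lemma retraction_coe {y : E3} (h : y ≠ 0) : (retraction y : E3) = ‖y‖⁻¹ • y := by
  simp [retraction, h]

lemma radialExt_eq (f : S2 → ℝ) {y : E3} (h : y ≠ 0) : radialExt f y = f (retraction y) := by
  simp [radialExt, retraction, h]

lemma norm_coe (x : S2) : ‖(x : E3)‖ = 1 := mem_sphere_zero_iff_norm.mp x.2

lemma coe_ne_zero (x : S2) : (x : E3) ≠ 0 := by
  intro h; have := norm_coe x; simp [h] at this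

lemma retraction_self (x : S2) : retraction x = x := by
  apply Subtype.ext; rw [retraction_coe (coe_ne_zero x), norm_coe]; simp

lemma radialExt_self (f : S2 → ℝ) (x : S2) : radialExt f x = f x := by
  rw [radialExt_eq f (coe_ne_zero x), retraction_self]

lemma contMDiffAt_retraction {y : E3} (h : y ≠ 0) :
    ContMDiffAt 𝓘(ℝ, E3) (𝓡 2) ∞ retraction y := by
  -- `codRestrict_sphere` takes a map smooth on its whole domain, so the origin is removed by
  -- passing to an open submanifold.
  let U : TopologicalSpace.Opens E3 := ⟨{0}ᶜ, isOpen_compl_singleton⟩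
  have key : ContMDiff 𝓘(ℝ, E3) (𝓡 2) ∞ (fun z : U => retraction (z : E3)) := by
    have h1 : ContMDiff 𝓘(ℝ, E3) 𝓘(ℝ, E3) ∞ (fun z : U => ‖(z : E3)‖⁻¹ • (z : E3)) := by
      intro z
      have hz : (z : E3) ≠ 0 := z.2
      have : ContDiffAt ℝ ∞ (fun z : E3 => ‖z‖⁻¹ • z) z :=
        ((contDiffAt_norm ℝ hz).inv (norm_ne_zero_iff.mpr hz)).smul contDiffAt_id
      exact (contMDiffAt_subtype_iff (f := fun z : E3 => ‖z‖⁻¹ • z)).mpr this.contMDiffAt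
    have h2 := h1.codRestrict_sphere (n := 2)
      (fun z => mem_sphere_zero_iff_norm.mpr (norm_smul_inv_norm (𝕜 := ℝ) z.2))
    exact h2.congr (fun z => Subtype.ext (retraction_coe z.2))
  exact (contMDiffAt_subtype_iff (U := U) (f := retraction) (x := ⟨y, h⟩)).mp (key _)

/-- Together with `SmoothOn.of_contDiffOn`, a dictionary between smoothness on the manifold and
smoothness on a subset of `ℝ × ℝ³`, where `fderivWithin` is available. -/
lemma SmoothOn.contDiffOn_radialExt {u₁ u₂ : ℝ} {f : ℝ → S2 → ℝ} (h : SmoothOn u₁ u₂ f) :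
    ContDiffOn ℝ ∞ (fun p : ℝ × E3 => radialExt (f p.1) p.2) (Icc u₁ u₂ ×ˢ {0}ᶜ) := by
  rw [← contMDiffOn_iff_contDiffOn]
  have h2 : ContMDiffOn 𝓘(ℝ, ℝ × E3) (𝓘(ℝ, ℝ).prod (𝓡 2)) ∞
      (fun p : ℝ × E3 => (p.1, retraction p.2)) (Icc u₁ u₂ ×ˢ {0}ᶜ) := by
    apply ContMDiffOn.prodMk
    · exact contDiff_fst.contMDiff.contMDiffOn
    · intro p hp
      exact ((contMDiffAt_retraction hp.2).comp p
        contDiff_snd.contMDiff.contMDiffAt).contMDiffWithinAt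
  have h3 := ContMDiffOn.comp h h2 (fun p hp => ⟨hp.1, trivial⟩)
  exact h3.congr fun p hp => radialExt_eq _ hp.2

/-- A smooth function on the sphere. -/
abbrev Smooth (f : S2 → ℝ) : Prop := ContMDiff (𝓡 2) 𝓘(ℝ, ℝ) ∞ f

lemma Smooth.contDiffAt {f : S2 → ℝ} (hf : Smooth f) {y : E3} (hy : y ≠ 0) :
    ContDiffAt ℝ ∞ (radialExt f) y := by
  have h := ContMDiffAt.comp y (hf _) (contMDiffAt_retraction hy)
  rw [contMDiffAt_iff_contDiffAt] at h
  refine h.congr_of_eventuallyEq ?_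
  filter_upwards [isOpen_compl_singleton.mem_nhds hy] with z hz
  exact radialExt_eq f hz

lemma Smooth.of_contDiffOn {f : S2 → ℝ} {g : E3 → ℝ} (hg : ContDiffOn ℝ ∞ g {0}ᶜ)
    (h : ∀ x : S2, f x = g x) : Smooth f := by
  have h3 := (contMDiffOn_iff_contDiffOn.mpr hg).comp
    (contMDiff_coe_sphere (n := 2) (E := E3) (m := ∞)).contMDiffOn (s := univ)
    (fun p _ => coe_ne_zero p)
  rw [contMDiffOn_univ] at h3
  exact h3.congr h

lemma Smooth.differentiableAt {f : S2 → ℝ} (hf : Smooth f) (x : S2) :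
    DifferentiableAt ℝ (radialExt f) (x : E3) :=
  (hf.contDiffAt (coe_ne_zero x)).differentiableAt (by simp)

lemma SmoothOn.smooth {u₁ u₂ : ℝ} {f : ℝ → S2 → ℝ} (hf : SmoothOn u₁ u₂ f) {u : ℝ}
    (hu : u ∈ Icc u₁ u₂) : Smooth (f u) := by
  have h2 : ContMDiff (𝓡 2) (𝓘(ℝ, ℝ).prod (𝓡 2)) ∞ (fun x : S2 => (u, x)) :=
    contMDiff_const.prodMk contMDiff_id
  have := ContMDiffOn.comp hf h2.contMDiffOn (s := univ) (fun _ _ => ⟨hu, trivial⟩)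
  rwa [contMDiffOn_univ] at this

lemma Smooth.smoothOn {f : S2 → ℝ} (hf : Smooth f) (u₁ u₂ : ℝ) :
    SmoothOn u₁ u₂ (fun _ => f) :=
  (hf.comp contMDiff_snd).contMDiffOn

lemma smooth_const (c : ℝ) : Smooth (fun _ => c) := contMDiff_const

lemma smooth_coord (k : Fin 3) : Smooth (coord k) :=
  Smooth.of_contDiffOn (g := fun y => y k) (by fun_prop) (fun _ => rfl)

section Closure
variable {u₁ u₂ : ℝ} {f g : ℝ → S2 → ℝ}

lemma SmoothOn.add (hf : SmoothOn u₁ u₂ f) (hg : SmoothOn u₁ u₂ g) :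
    SmoothOn u₁ u₂ (fun u x => f u x + g u x) := ContMDiffOn.add hf hg

lemma SmoothOn.sub (hf : SmoothOn u₁ u₂ f) (hg : SmoothOn u₁ u₂ g) :
    SmoothOn u₁ u₂ (fun u x => f u x - g u x) := ContMDiffOn.sub hf hg

lemma SmoothOn.mul (hf : SmoothOn u₁ u₂ f) (hg : SmoothOn u₁ u₂ g) :
    SmoothOn u₁ u₂ (fun u x => f u x * g u x) := ContMDiffOn.mul hf hg

lemma smoothOn_time (u₁ u₂ : ℝ) : SmoothOn u₁ u₂ (fun u _ => u) :=
  contMDiff_fst.contMDiffOn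

lemma smoothOn_pi {F : Type*} [NormedAddCommGroup F] [NormedSpace ℝ F]
    {w : ℝ → S2 → Fin 3 → F} :
    SmoothOn u₁ u₂ w ↔ ∀ i, SmoothOn u₁ u₂ (fun u x => w u x i) :=
  contMDiffOn_pi_space

end Closure

section Closure
variable {f g : S2 → ℝ}

lemma Smooth.add (hf : Smooth f) (hg : Smooth g) : Smooth (fun x => f x + g x) :=
  ContMDiff.add hf hg

lemma Smooth.sub (hf : Smooth f) (hg : Smooth g) : Smooth (fun x => f x - g x) :=
  ContMDiff.sub hf hg

lemma Smooth.neg (hf : Smooth f) : Smooth (fun x => - f x) := by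
  simpa using (smooth_const 0).sub hf

lemma Smooth.mul (hf : Smooth f) (hg : Smooth g) : Smooth (fun x => f x * g x) :=
  ContMDiff.mul hf hg

lemma Smooth.sum {f : Fin 3 → S2 → ℝ} (hf : ∀ i, Smooth (f i)) :
    Smooth (fun x => ∑ i, f i x) := by
  simp only [Fin.sum_univ_three]
  exact ((hf 0).add (hf 1)).add (hf 2)

end Closure

/-! ### The derivations `∂_a` on smooth functions -/

section Derivation
variable {f g : S2 → ℝ}

lemma partialDeriv_add (a : Fin 3) (hf : Smooth f) (hg : Smooth g) (x : S2) :
    partialDeriv a (fun y => f y + g y) x = partialDeriv a f x + partialDeriv a g x := by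
  have : radialExt (fun y => f y + g y) = radialExt f + radialExt g := by
    funext y; simp only [radialExt, Pi.add_apply]; split_ifs <;> simp
  simp only [partialDeriv, this]
  rw [fderiv_add (hf.differentiableAt x) (hg.differentiableAt x)]; rfl

lemma partialDeriv_mul (a : Fin 3) (hf : Smooth f) (hg : Smooth g) (x : S2) :
    partialDeriv a (fun y => f y * g y) x
      = partialDeriv a f x * g x + f x * partialDeriv a g x := by
  have : radialExt (fun y => f y * g y) = radialExt f * radialExt g := by
    funext y; simp only [radialExt, Pi.mul_apply]; split_ifs <;> simp
  simp only [partialDeriv, this]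
  rw [fderiv_mul (hf.differentiableAt x) (hg.differentiableAt x)]
  simp [radialExt_self]; ring

lemma partialDeriv_const (a : Fin 3) (c : ℝ) (x : S2) :
    partialDeriv a (fun _ => c) x = 0 := by
  -- The extension takes the value `0` at the origin, so it is constant only locally.
  have : radialExt (fun _ => c) =ᶠ[𝓝 (x : E3)] fun _ => c := by
    filter_upwards [isOpen_compl_singleton.mem_nhds (coe_ne_zero x)] with z hz
    exact radialExt_eq _ hz
  simp [partialDeriv, this.fderiv_eq]

lemma partialDeriv_const_mul (a : Fin 3) (c : ℝ) (hf : Smooth f) (x : S2) :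
    partialDeriv a (fun y => c * f y) x = c * partialDeriv a f x := by
  rw [partialDeriv_mul a (smooth_const c) hf, partialDeriv_const]; ring

lemma partialDeriv_neg (a : Fin 3) (hf : Smooth f) (x : S2) :
    partialDeriv a (fun y => - f y) x = - partialDeriv a f x := by
  simpa using partialDeriv_const_mul a (-1) hf x

lemma partialDeriv_sub (a : Fin 3) (hf : Smooth f) (hg : Smooth g) (x : S2) :
    partialDeriv a (fun y => f y - g y) x = partialDeriv a f x - partialDeriv a g x := by
  simpa [sub_eq_add_neg, partialDeriv_neg a hg x] using partialDeriv_add a hf hg.neg x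

lemma partialDeriv_sum (a : Fin 3) {f : Fin 3 → S2 → ℝ} (hf : ∀ i, Smooth (f i)) (x : S2) :
    partialDeriv a (fun y => ∑ i, f i y) x = ∑ i, partialDeriv a (f i) x := by
  simp only [Fin.sum_univ_three]
  rw [partialDeriv_add a ((hf 0).add (hf 1)) (hf 2), partialDeriv_add a (hf 0) (hf 1)]

lemma sum_coord_sq (x : S2) : ∑ a, (x : E3) a * (x : E3) a = 1 := by
  have h := EuclideanSpace.norm_sq_eq (x : E3)
  rw [norm_coe] at h
  simpa [sq] using h.symm

lemma sum_smul_single (y : E3) : ∑ a, y a • EuclideanSpace.single a (1 : ℝ) = y := by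
  ext i; fin_cases i <;> simp [Fin.sum_univ_three]

lemma radialExt_smul (f : S2 → ℝ) {c : ℝ} (hc : 0 < c) (y : E3) :
    radialExt f (c • y) = radialExt f y := by
  by_cases hy : y = 0
  · simp [hy]
  · rw [radialExt_eq f (smul_ne_zero hc.ne' hy), radialExt_eq f hy]
    congr 1
    apply Subtype.ext
    rw [retraction_coe (smul_ne_zero hc.ne' hy), retraction_coe hy, norm_smul, smul_smul,
      Real.norm_of_nonneg hc.le]
    congr 1
    field_simp

/-- The differential of a function homogeneous of degree `0` is homogeneous of degree `-1`. -/
lemma fderiv_radialExt_smul (hf : Smooth f) {c : ℝ} (hc : 0 < c) {y : E3} (hy : y ≠ 0) :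
    c • fderiv ℝ (radialExt f) (c • y) = fderiv ℝ (radialExt f) y := by
  have h1 : HasFDerivAt (fun z : E3 => c • z) (c • ContinuousLinearMap.id ℝ E3) y :=
    (hasFDerivAt_id y).const_smul c
  have h2 := ((hf.contDiffAt (smul_ne_zero hc.ne' hy)).differentiableAt
    (by simp)).hasFDerivAt.comp y h1
  have h3 : radialExt f ∘ (fun z : E3 => c • z) = radialExt f :=
    funext fun z => radialExt_smul f hc z
  rw [h3] at h2
  rw [h2.fderiv]
  ext v; simp

/-- Euler's identity in degree `0`: the extension is constant along the ray through `x`. -/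
lemma sum_coord_mul_partialDeriv (hf : Smooth f) (x : S2) :
    ∑ a, (x : E3) a * partialDeriv a f x = 0 := by
  have h1 : HasDerivAt (fun t : ℝ => t • (x : E3)) ((1 : ℝ) • (x : E3)) 1 :=
    (hasDerivAt_id (1 : ℝ)).smul_const _
  have h0 := (hf.differentiableAt x).hasFDerivAt
  have h2 := HasFDerivAt.comp_hasDerivAt_of_eq (1 : ℝ) h0 h1 (by simp)
  have h3 : (radialExt f ∘ fun t : ℝ => t • (x : E3)) =ᶠ[𝓝 1] fun _ => radialExt f x := by
    filter_upwards [Ioi_mem_nhds (show (0 : ℝ) < 1 by norm_num)] with t ht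
    exact radialExt_smul f ht _
  have h4 := (h2.congr_of_eventuallyEq h3.symm).unique (hasDerivAt_const (1 : ℝ) (radialExt f x))
  rw [one_smul] at h4
  have h5 : fderiv ℝ (radialExt f) x (∑ a, (x : E3) a • EuclideanSpace.single a (1 : ℝ)) = 0 := by
    rw [sum_smul_single]; exact h4
  rw [map_sum] at h5
  simpa only [map_smul, smul_eq_mul, partialDeriv] using h5

lemma hasFDerivAt_norm (x : S2) :
    HasFDerivAt (fun y : E3 => ‖y‖) (innerSL ℝ (x : E3)) x := by
  have h := (hasStrictFDerivAt_norm_sq (x : E3)).hasFDerivAt.sqrt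
    (by rw [norm_coe]; norm_num)
  have e : (fun y : E3 => √(‖y‖ ^ 2)) = fun y => ‖y‖ := by
    funext y; exact Real.sqrt_sq (norm_nonneg y)
  rw [e] at h
  refine h.congr_fderiv ?_
  ext v; simp

lemma partialDeriv_coord (a b : Fin 3) (x : S2) : partialDeriv a (coord b) x = metric x a b := by
  have e : radialExt (coord b) =ᶠ[𝓝 (x : E3)] fun y => ‖y‖⁻¹ * y b := by
    filter_upwards [isOpen_compl_singleton.mem_nhds (coe_ne_zero x)] with z hz
    rw [radialExt_eq _ hz, coord, retraction_coe hz]; simp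
  have h1 : HasFDerivAt (fun y : E3 => y b) (EuclideanSpace.proj b : E3 →L[ℝ] ℝ) x :=
    (EuclideanSpace.proj b : E3 →L[ℝ] ℝ).hasFDerivAt
  have h2 := ((hasDerivAt_inv (by rw [norm_coe]; norm_num)).comp_hasFDerivAt (x : E3)
    (hasFDerivAt_norm x)).mul h1
  have h3 := (h2.congr_of_eventuallyEq e).fderiv
  rw [partialDeriv, h3, metric]
  simp [eq_comm, EuclideanSpace.inner_single_right]
  ring

lemma smooth_partialDeriv (a : Fin 3) (hf : Smooth f) : Smooth (partialDeriv a f) := by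
  refine Smooth.of_contDiffOn
    (g := fun y => fderiv ℝ (radialExt f) y (EuclideanSpace.single a 1)) ?_ (fun _ => rfl)
  intro y hy
  exact (((hf.contDiffAt hy).fderiv_right (m := ∞) (by simp)).clm_apply
    contDiffAt_const).contDiffWithinAt

/-- The left side has degree `0` and the Euclidean derivative degree `-1`; the factor `‖y‖` makes up
for the difference. It is the source of the commutator of the `∂_a`. -/
lemma radialExt_partialDeriv (b : Fin 3) (hf : Smooth f) {y : E3} (hy : y ≠ 0) :
    radialExt (partialDeriv b f) y
      = ‖y‖ * fderiv ℝ (radialExt f) y (EuclideanSpace.single b 1) := by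
  have hy' := norm_pos_iff.mpr hy
  rw [radialExt_eq _ hy, partialDeriv, retraction_coe hy,
    ← fderiv_radialExt_smul hf (inv_pos.mpr hy') hy]
  simp [hy'.ne']

lemma partialDeriv_partialDeriv (a b : Fin 3) (hf : Smooth f) (x : S2) :
    partialDeriv a (partialDeriv b f) x = (x : E3) a * partialDeriv b f x
      + fderiv ℝ (fderiv ℝ (radialExt f)) x (EuclideanSpace.single a 1)
          (EuclideanSpace.single b 1) := by
  have e : radialExt (partialDeriv b f) =ᶠ[𝓝 (x : E3)] fun y =>
      ‖y‖ * fderiv ℝ (radialExt f) y (EuclideanSpace.single b 1) := by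
    filter_upwards [isOpen_compl_singleton.mem_nhds (coe_ne_zero x)] with z hz
    exact radialExt_partialDeriv b hf hz
  have h1 : DifferentiableAt ℝ (fderiv ℝ (radialExt f)) x :=
    ((hf.contDiffAt (coe_ne_zero x)).fderiv_right (m := ∞) (by simp)).differentiableAt (by simp)
  have h2 := (hasFDerivAt_norm x).mul
    (h1.hasFDerivAt.clm_apply (hasFDerivAt_const (EuclideanSpace.single b (1 : ℝ)) (x : E3)))
  have h3 := (h2.congr_of_eventuallyEq e).fderiv
  rw [partialDeriv, h3]
  simp [partialDeriv, EuclideanSpace.inner_single_right]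
  ring

lemma two_le_smooth : minSmoothness ℝ 2 ≤ (∞ : ℕ∞ω) := by
  rw [minSmoothness_of_isRCLikeNormedField]; 
  exact WithTop.coe_le_coe.mpr (le_top : (2 : ℕ∞) ≤ ⊤)

/-- The Euclidean second derivatives cancel by symmetry, leaving the derivatives of the factor
`‖y‖`. -/
lemma partialDeriv_comm (a b : Fin 3) (hf : Smooth f) (x : S2) :
    partialDeriv a (partialDeriv b f) x - partialDeriv b (partialDeriv a f) x
      = (x : E3) a * partialDeriv b f x - (x : E3) b * partialDeriv a f x := by
  have hs : IsSymmSndFDerivAt ℝ (radialExt f) (x : E3) :=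
    (hf.contDiffAt (coe_ne_zero x)).isSymmSndFDerivAt two_le_smooth
  rw [partialDeriv_partialDeriv a b hf, partialDeriv_partialDeriv b a hf, hs.eq]
  ring

end Derivation

/-! ### Time derivatives -/

section Time
variable {u₁ u₂ : ℝ}

lemma SmoothOn.of_contDiffOn {f : ℝ → S2 → ℝ} {H : ℝ × E3 → ℝ}
    (hH : ContDiffOn ℝ ∞ H (Icc u₁ u₂ ×ˢ {0}ᶜ))
    (h : ∀ u ∈ Icc u₁ u₂, ∀ x : S2, f u x = H (u, x)) : SmoothOn u₁ u₂ f := by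
  have h2 : ContMDiff (𝓘(ℝ, ℝ).prod (𝓡 2)) 𝓘(ℝ, ℝ × E3) ∞
      (fun p : ℝ × S2 => (p.1, (p.2 : E3))) :=
    ContMDiff.prodMk_space contMDiff_fst ((contMDiff_coe_sphere (n := 2)).comp contMDiff_snd)
  have h3 := (contMDiffOn_iff_contDiffOn.mpr hH).comp h2.contMDiffOn (s := Icc u₁ u₂ ×ˢ univ)
    (fun p hp => ⟨hp.1, coe_ne_zero p.2⟩)
  exact h3.congr (fun p hp => h _ hp.1 _)

/-- The extension of a time-dependent function on the sphere to `ℝ × ℝ³`. -/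
def radialExtTime (f : ℝ → S2 → ℝ) (p : ℝ × E3) : ℝ := radialExt (f p.1) p.2

lemma uniqueDiffOn_slab (hu : u₁ < u₂) :
    UniqueDiffOn ℝ (Icc u₁ u₂ ×ˢ ({0}ᶜ : Set E3)) :=
  (uniqueDiffOn_Icc hu).prod isOpen_compl_singleton.uniqueDiffOn

lemma SmoothOn.contDiffOn {f : ℝ → S2 → ℝ} (hf : SmoothOn u₁ u₂ f) :
    ContDiffOn ℝ ∞ (radialExtTime f) (Icc u₁ u₂ ×ˢ {0}ᶜ) := hf.contDiffOn_radialExt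

lemma SmoothOn.hasFDerivWithinAt {f : ℝ → S2 → ℝ} (hf : SmoothOn u₁ u₂ f) {u : ℝ}
    (hu : u ∈ Icc u₁ u₂) {y : E3} (hy : y ≠ 0) :
    HasFDerivWithinAt (radialExtTime f)
      (fderivWithin ℝ (radialExtTime f) (Icc u₁ u₂ ×ˢ {0}ᶜ) (u, y)) (Icc u₁ u₂ ×ˢ {0}ᶜ) (u, y) :=
  (hf.contDiffOn.differentiableOn (by simp) (u, y) ⟨hu, hy⟩).hasFDerivWithinAt

lemma SmoothOn.partialDeriv_eq {f : ℝ → S2 → ℝ} (hf : SmoothOn u₁ u₂ f) (a : Fin 3) {u : ℝ}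
    (hu : u ∈ Icc u₁ u₂) (x : S2) :
    partialDeriv a (f u) x = fderivWithin ℝ (radialExtTime f) (Icc u₁ u₂ ×ˢ {0}ᶜ) (u, x)
      (0, EuclideanSpace.single a 1) := by
  have h1 : HasFDerivAt (fun y : E3 => (u, y)) (ContinuousLinearMap.inr ℝ ℝ E3) (x : E3) :=
    hasFDerivAt_prodMk_right u (x : E3)
  have h2 := ((hf.hasFDerivWithinAt hu (coe_ne_zero x)).comp (x : E3)
    (h1.hasFDerivWithinAt (s := {0}ᶜ)) (fun y hy => ⟨hu, hy⟩)).hasFDerivAt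
    (isOpen_compl_singleton.mem_nhds (coe_ne_zero x))
  have e : radialExtTime f ∘ (fun y : E3 => (u, y)) = radialExt (f u) := rfl
  rw [e] at h2
  rw [partialDeriv, h2.fderiv]; simp

lemma SmoothOn.partialDeriv {f : ℝ → S2 → ℝ} (h12 : u₁ < u₂) (a : Fin 3)
    (hf : SmoothOn u₁ u₂ f) : SmoothOn u₁ u₂ (fun u => partialDeriv a (f u)) := by
  refine SmoothOn.of_contDiffOn (H := fun p =>
    fderivWithin ℝ (radialExtTime f) (Icc u₁ u₂ ×ˢ {0}ᶜ) p (0, EuclideanSpace.single a 1)) ?_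
    (fun u hu x => hf.partialDeriv_eq a hu x)
  exact (hf.contDiffOn.fderivWithin (uniqueDiffOn_slab h12) (m := ∞) (by simp)).clm_apply
    contDiffOn_const

/-- `g` is the time derivative of `f` on `[u₁, u₂] × S²`, both being smooth. -/
structure TimeDeriv (u₁ u₂ : ℝ) (f g : ℝ → S2 → ℝ) : Prop where
  smooth : SmoothOn u₁ u₂ f
  smooth_deriv : SmoothOn u₁ u₂ g
  hasDeriv : ∀ u ∈ Icc u₁ u₂, ∀ x,
    HasDerivWithinAt (fun v => f v x) (g u x) (Icc u₁ u₂) u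

lemma TimeDeriv.fderivWithin_time {f g : ℝ → S2 → ℝ} (h12 : u₁ < u₂) (h : TimeDeriv u₁ u₂ f g)
    {u : ℝ} (hu : u ∈ Icc u₁ u₂) {y : E3} (hy : y ≠ 0) :
    fderivWithin ℝ (radialExtTime f) (Icc u₁ u₂ ×ˢ {0}ᶜ) (u, y) (1, 0) = radialExtTime g (u, y) := by
  have h1 : HasDerivWithinAt (fun v : ℝ => (v, y)) ((1 : ℝ), (0 : E3)) (Icc u₁ u₂) u :=
    (hasDerivWithinAt_id _ _).prodMk (hasDerivWithinAt_const _ _ _)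
  have h2 := (h.smooth.hasFDerivWithinAt hu hy).comp_hasDerivWithinAt u h1
    (fun v hv => (⟨hv, hy⟩ : (v, y) ∈ Icc u₁ u₂ ×ˢ ({0}ᶜ : Set E3)))
  have h3 := h.hasDeriv u hu (retraction y)
  have e : (radialExtTime f ∘ fun v : ℝ => (v, y)) = fun v => f v (retraction y) :=
    funext fun v => radialExt_eq _ hy
  rw [e] at h2
  have := (uniqueDiffOn_Icc h12 u hu).eq_deriv _ h2 h3
  rw [this]; exact (radialExt_eq _ hy).symm

/-- Both sides are the mixed second derivative of `F` along `(1, 0)` and `(0, e)`; `S` need not be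
open, because `D²F` within `S` is symmetric at limits of interior points. -/
lemma hasDerivWithinAt_fderivWithin_comm {E : Type*} [NormedAddCommGroup E] [NormedSpace ℝ E]
    {F g : ℝ × E → ℝ} {S : Set (ℝ × E)} {I : Set ℝ} {u : ℝ} {y e : E}
    (hF : ContDiffOn ℝ ∞ F S) (hU : UniqueDiffOn ℝ S) (hmem : (u, y) ∈ S)
    (hcl : (u, y) ∈ closure (interior S)) (hI : ∀ v ∈ I, (v, y) ∈ S)
    (hg : ∀ q ∈ S, fderivWithin ℝ F S q (1, 0) = g q) :
    HasDerivWithinAt (fun v => fderivWithin ℝ F S (v, y) (0, e))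
      (fderivWithin ℝ g S (u, y) (0, e)) I u := by
  have hGd : HasFDerivWithinAt (fderivWithin ℝ F S)
      (fderivWithin ℝ (fderivWithin ℝ F S) S (u, y)) S (u, y) :=
    ((hF.fderivWithin hU (m := ∞) (by simp)).differentiableOn (by simp) _ hmem).hasFDerivWithinAt
  have hsymm : IsSymmSndFDerivWithinAt ℝ F S (u, y) :=
    (hF _ hmem).isSymmSndFDerivWithinAt two_le_smooth hU hcl hmem
  have h1 : HasDerivWithinAt (fun v : ℝ => (v, y)) ((1 : ℝ), (0 : E)) I u :=
    (hasDerivWithinAt_id _ _).prodMk (hasDerivWithinAt_const _ _ _)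
  have h2 := (ContinuousLinearMap.apply ℝ ℝ ((0 : ℝ), e)).hasFDerivAt.comp_hasDerivWithinAt u
    (hGd.comp_hasDerivWithinAt u h1 hI)
  have h3 : HasFDerivWithinAt g
      ((ContinuousLinearMap.apply ℝ ℝ ((1 : ℝ), (0 : E))).comp
        (fderivWithin ℝ (fderivWithin ℝ F S) S (u, y))) S (u, y) :=
    ((ContinuousLinearMap.apply ℝ ℝ
      ((1 : ℝ), (0 : E))).hasFDerivAt.comp_hasFDerivWithinAt _ hGd).congr'
      (fun p hp => (hg p hp).symm) hmem
  have h4 : fderivWithin ℝ g S (u, y) (0, e)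
      = fderivWithin ℝ (fderivWithin ℝ F S) S (u, y) (1, 0) (0, e) := by
    rw [h3.fderivWithin (hU _ hmem), hsymm.eq]; rfl
  rw [h4]
  exact h2

lemma TimeDeriv.partialDeriv {f g : ℝ → S2 → ℝ} (h12 : u₁ < u₂) (a : Fin 3)
    (h : TimeDeriv u₁ u₂ f g) :
    TimeDeriv u₁ u₂ (fun u => partialDeriv a (f u)) (fun u => partialDeriv a (g u)) := by
  refine ⟨h.smooth.partialDeriv h12 a, h.smooth_deriv.partialDeriv h12 a, fun u hu x => ?_⟩
  have hx := coe_ne_zero x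
  -- The end times are not interior, but they are limits of interior times, which suffices for
  -- symmetry.
  have hcl : (u, (x : E3)) ∈ closure (interior (Icc u₁ u₂ ×ˢ ({0}ᶜ : Set E3))) := by
    rw [interior_prod_eq, interior_Icc, isOpen_compl_singleton.interior_eq, closure_prod_eq,
      closure_Ioo h12.ne]
    exact ⟨hu, subset_closure hx⟩
  have h1 := hasDerivWithinAt_fderivWithin_comm (e := EuclideanSpace.single a (1 : ℝ))
    h.smooth.contDiffOn (uniqueDiffOn_slab h12) ⟨hu, hx⟩ hcl (I := Icc u₁ u₂)
    (fun v hv => ⟨hv, hx⟩) (fun q hq => h.fderivWithin_time h12 hq.1 hq.2)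
  rw [h.smooth_deriv.partialDeriv_eq a hu x]
  exact h1.congr (fun v hv => h.smooth.partialDeriv_eq a hv x) (h.smooth.partialDeriv_eq a hu x)

section Closure
variable {f f' g g' : ℝ → S2 → ℝ}

lemma TimeDeriv.add (hf : TimeDeriv u₁ u₂ f f') (hg : TimeDeriv u₁ u₂ g g') :
    TimeDeriv u₁ u₂ (fun u x => f u x + g u x) (fun u x => f' u x + g' u x) :=
  ⟨hf.smooth.add hg.smooth, hf.smooth_deriv.add hg.smooth_deriv,
    fun u hu x => (hf.hasDeriv u hu x).add (hg.hasDeriv u hu x)⟩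

lemma TimeDeriv.sub (hf : TimeDeriv u₁ u₂ f f') (hg : TimeDeriv u₁ u₂ g g') :
    TimeDeriv u₁ u₂ (fun u x => f u x - g u x) (fun u x => f' u x - g' u x) :=
  ⟨hf.smooth.sub hg.smooth, hf.smooth_deriv.sub hg.smooth_deriv,
    fun u hu x => (hf.hasDeriv u hu x).sub (hg.hasDeriv u hu x)⟩

lemma TimeDeriv.sum {f f' : Fin 3 → ℝ → S2 → ℝ} (hf : ∀ i, TimeDeriv u₁ u₂ (f i) (f' i)) :
    TimeDeriv u₁ u₂ (fun u x => ∑ i, f i u x) (fun u x => ∑ i, f' i u x) := by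
  simp only [Fin.sum_univ_three]
  exact ((hf 0).add (hf 1)).add (hf 2)

lemma TimeDeriv.smooth_mul {φ : S2 → ℝ} (hφ : Smooth φ) (hf : TimeDeriv u₁ u₂ f f') :
    TimeDeriv u₁ u₂ (fun u x => φ x * f u x) (fun u x => φ x * f' u x) :=
  ⟨(hφ.smoothOn _ _).mul hf.smooth, (hφ.smoothOn _ _).mul hf.smooth_deriv,
    fun u hu x => (hf.hasDeriv u hu x).const_mul _⟩

end Closure
end Time

/-! ### Time primitives depending smoothly on a parameter -/

section Primitive

set_option linter.unusedSectionVars false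

/-- The primitive in the first variable with base point `a`. -/
def timePrimitive {E G : Type} [NormedAddCommGroup G] [NormedSpace ℝ G] (a : ℝ) (F : ℝ × E → G)
    (p : ℝ × E) : G := ∫ v in a..p.1, F (v, p.2)

lemma continuousOn_slice {E G : Type} [TopologicalSpace E] [TopologicalSpace G] {a b : ℝ}
    {U : Set E} {F : ℝ × E → G} (hF : ContinuousOn F (Icc a b ×ˢ U)) {y : E} (hy : y ∈ U) :
    ContinuousOn (fun v => F (v, y)) (Icc a b) :=
  hF.comp (by fun_prop) (fun _ hv => ⟨hv, hy⟩)

lemma intervalIntegrable_slice {E G : Type} [TopologicalSpace E] [NormedAddCommGroup G] {a b : ℝ}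
    {U : Set E} {F : ℝ × E → G} (hF : ContinuousOn F (Icc a b ×ˢ U)) {y : E} (hy : y ∈ U)
    {s t : ℝ} (hs : s ∈ Icc a b) (ht : t ∈ Icc a b) :
    IntervalIntegrable (fun v => F (v, y)) MeasureTheory.volume s t :=
  ((continuousOn_slice hF hy).mono (uIcc_subset_Icc hs ht)).intervalIntegrable

variable {E : Type} [NormedAddCommGroup E] [NormedSpace ℝ E] [ProperSpace E]
  {G : Type} [NormedAddCommGroup G] [NormedSpace ℝ G] [CompleteSpace G]
  {a b : ℝ} {U : Set E} {F : ℝ × E → G}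

lemma continuousOn_timePrimitive (hab : a ≤ b) (hF : ContinuousOn F (Icc a b ×ˢ U)) :
    ContinuousOn (timePrimitive a F) (Icc a b ×ˢ U) := by
  rw [continuousOn_iff_continuous_domRestrict] at hF ⊢
  -- Clamping the time to `[a, b]` gives an integrand continuous for all times, without changing the
  -- integral.
  let f : ↥(Icc a b ×ˢ U) → ℝ → G := fun p t =>
    (Icc a b ×ˢ U).domRestrict F ⟨((projIcc a b hab t : ℝ), p.1.2), ⟨(projIcc a b hab t).2, p.2.2⟩⟩
  have hf : Continuous (Function.uncurry f) := by
    refine hF.comp (Continuous.subtype_mk ?_ _)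
    exact (continuous_subtype_val.comp (continuous_projIcc.comp continuous_snd)).prodMk
      (continuous_snd.comp (continuous_subtype_val.comp continuous_fst))
  have h := intervalIntegral.continuous_parametric_intervalIntegral_of_continuous
    (μ := MeasureTheory.volume) (a₀ := a) hf
    (s := fun p => p.1.1) (continuous_fst.comp continuous_subtype_val)
  refine h.congr fun p => ?_
  refine intervalIntegral.integral_congr fun t ht => ?_
  have ht' : t ∈ Icc a b := uIcc_subset_Icc ⟨le_rfl, hab⟩ p.2.1 ht
  simp [f, projIcc_of_mem hab ht']

/-- The contribution of the moving end point. Continuity of `F` suffices: the error is an integral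
of something at most `ε` over an interval of length `|p.1 - u|`. -/
lemma hasFDerivWithinAt_timePrimitive_fst (hF : ContinuousOn F (Icc a b ×ˢ U)) {u : ℝ} {y : E}
    (hu : u ∈ Icc a b) (hy : y ∈ U) :
    HasFDerivWithinAt (fun p : ℝ × E => ∫ v in u..p.1, F (v, p.2))
      ((ContinuousLinearMap.fst ℝ ℝ E).smulRight (F (u, y))) (Icc a b ×ˢ U) (u, y) := by
  rw [hasFDerivWithinAt_iff_isLittleO, Asymptotics.isLittleO_iff]
  intro ε hε
  obtain ⟨δ, hδ, hball⟩ := Metric.continuousWithinAt_iff.mp (hF (u, y) ⟨hu, hy⟩) ε hε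
  filter_upwards [inter_mem_nhdsWithin _ (Metric.ball_mem_nhds (u, y) hδ)] with p hp
  obtain ⟨⟨hp1, hp2⟩, hpb⟩ := hp
  have hpu : |p.1 - u| < δ := (le_max_left _ _).trans_lt hpb
  have hpy : dist p.2 y < δ := (le_max_right _ _).trans_lt hpb
  have e : (∫ v in u..p.1, F (v, p.2)) - (∫ v in u..u, F (v, y))
      - ((ContinuousLinearMap.fst ℝ ℝ E).smulRight (F (u, y))) (p - (u, y))
      = ∫ v in u..p.1, (F (v, p.2) - F (u, y)) := by
    rw [intervalIntegral.integral_sub (intervalIntegrable_slice hF hp2 hu hp1)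
      intervalIntegrable_const]
    simp
  rw [e]
  have hle : ∀ v ∈ uIoc u p.1, ‖F (v, p.2) - F (u, y)‖ ≤ ε := by
    intro v hv
    rw [← dist_eq_norm]
    refine (hball (x := (v, p.2)) ⟨uIcc_subset_Icc hu hp1 (uIoc_subset_uIcc hv), hp2⟩ ?_).le
    refine max_lt ?_ hpy
    refine lt_of_le_of_lt ?_ hpu
    exact abs_sub_left_of_mem_uIcc (uIoc_subset_uIcc hv)
  refine (intervalIntegral.norm_integral_le_of_norm_le_const hle).trans ?_
  gcongr
  exact norm_fst_le (p - (u, y))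

lemma hasFDerivAt_timePrimitive_snd (hab : a ≤ b) (hU : IsOpen U)
    {F' : ℝ × E → E →L[ℝ] G} (hF : ContinuousOn F (Icc a b ×ˢ U))
    (hF' : ContinuousOn F' (Icc a b ×ˢ U))
    (hd : ∀ u ∈ Icc a b, ∀ y ∈ U, HasFDerivAt (fun z => F (u, z)) (F' (u, y)) y)
    {u : ℝ} {y : E} (hu : u ∈ Icc a b) (hy : y ∈ U) :
    HasFDerivAt (fun z => ∫ v in a..u, F (v, z)) (∫ v in a..u, F' (v, y)) y := by
  obtain ⟨r, hr, hrU⟩ := Metric.nhds_basis_closedBall.mem_iff.mp (hU.mem_nhds hy)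
  have ha : a ∈ Icc a b := ⟨le_rfl, hab⟩
  -- Compactness of `[a, b]` times a closed ball provides the constant dominating function.
  obtain ⟨C, hC⟩ := (isCompact_Icc.prod (isCompact_closedBall y r)).exists_bound_of_continuousOn
    (hF'.mono (prod_mono_right hrU))
  have hsub : ∀ t ∈ uIoc a u, t ∈ Icc a b := fun t ht =>
    uIcc_subset_Icc ha hu (uIoc_subset_uIcc ht)
  refine intervalIntegral.hasFDerivAt_integral_of_dominated_of_fderiv_le
    (F := fun z v => F (v, z)) (F' := fun z v => F' (v, z)) (bound := fun _ => C)
    (s := Metric.closedBall y r) (Metric.closedBall_mem_nhds y hr) ?_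
    (intervalIntegrable_slice hF hy ha hu) ?_ ?_ intervalIntegrable_const ?_
  · filter_upwards [hU.mem_nhds hy] with z hz
    exact (intervalIntegrable_slice hF hz ha hu).aestronglyMeasurable_restrict_uIoc
  · exact (intervalIntegrable_slice hF' hy ha hu).aestronglyMeasurable_restrict_uIoc
  · exact Filter.Eventually.of_forall fun t ht z hz => hC (t, z) ⟨hsub t ht, hz⟩
  · exact Filter.Eventually.of_forall fun t ht z hz => hd t (hsub t ht) z (hrU hz)

/-- The integral is split at `u`: the part over `[a, u]` is differentiated under the integral sign,
the rest through its end point. -/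
lemma hasFDerivWithinAt_timePrimitive (hab : a ≤ b) (hU : IsOpen U)
    {F' : ℝ × E → E →L[ℝ] G} (hF : ContinuousOn F (Icc a b ×ˢ U))
    (hF' : ContinuousOn F' (Icc a b ×ˢ U))
    (hd : ∀ u ∈ Icc a b, ∀ y ∈ U, HasFDerivAt (fun z => F (u, z)) (F' (u, y)) y)
    {p : ℝ × E} (hp : p ∈ Icc a b ×ˢ U) :
    HasFDerivWithinAt (timePrimitive a F)
      ((timePrimitive a F' p).comp (ContinuousLinearMap.snd ℝ ℝ E)
        + (ContinuousLinearMap.fst ℝ ℝ E).smulRight (F p)) (Icc a b ×ˢ U) p := by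
  obtain ⟨u, y⟩ := p
  have ha : a ∈ Icc a b := ⟨le_rfl, hab⟩
  have h1 : HasFDerivWithinAt (fun p : ℝ × E => ∫ v in a..u, F (v, p.2))
      ((timePrimitive a F' (u, y)).comp (ContinuousLinearMap.snd ℝ ℝ E)) (Icc a b ×ˢ U) (u, y) :=
    ((hasFDerivAt_timePrimitive_snd hab hU hF hF' hd hp.1 hp.2).comp (u, y)
      (ContinuousLinearMap.snd ℝ ℝ E).hasFDerivAt).hasFDerivWithinAt
  refine (h1.add (hasFDerivWithinAt_timePrimitive_fst hF hp.1 hp.2)).congr' (fun q hq => ?_) hp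
  exact (intervalIntegral.integral_add_adjacent_intervals
    (intervalIntegrable_slice hF hq.2 ha hp.1)
    (intervalIntegrable_slice hF hq.2 hp.1 hq.1)).symm

/-- The derivative of a primitive consists of `F` and the primitive of the spatial derivative of
`F`, so one order is gained per step. The latter takes values in `E →L[ℝ] G`, which is why `G` is
quantified inside the induction. -/
lemma contDiffOn_timePrimitive_nat (hab : a < b) (hU : IsOpen U) (n : ℕ) :
    ∀ {G : Type} [NormedAddCommGroup G] [NormedSpace ℝ G] [CompleteSpace G] {F : ℝ × E → G},
      ContDiffOn ℝ n F (Icc a b ×ˢ U) → ContDiffOn ℝ n (timePrimitive a F) (Icc a b ×ˢ U) := by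
  have hS : UniqueDiffOn ℝ (Icc a b ×ˢ U) := (uniqueDiffOn_Icc hab).prod hU.uniqueDiffOn
  induction n with
  | zero =>
    intro G _ _ _ F hF
    rw [Nat.cast_zero, contDiffOn_zero] at hF ⊢
    exact continuousOn_timePrimitive hab.le hF
  | succ n ih =>
    intro G _ _ _ F hF
    rw [Nat.cast_succ] at hF ⊢
    set F' : ℝ × E → E →L[ℝ] G := fun p =>
      (fderivWithin ℝ F (Icc a b ×ˢ U) p).comp (ContinuousLinearMap.inr ℝ ℝ E) with hF'def
    have hF' : ContDiffOn ℝ n F' (Icc a b ×ˢ U) :=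
      (hF.fderivWithin hS le_rfl).clm_comp contDiffOn_const
    have hd : ∀ u ∈ Icc a b, ∀ y ∈ U, HasFDerivAt (fun z => F (u, z)) (F' (u, y)) y := by
      intro u hu y hy
      have h0 := (hF.differentiableOn (by simp) (u, y) ⟨hu, hy⟩).hasFDerivWithinAt
      exact (h0.comp y ((hasFDerivAt_prodMk_right u y).hasFDerivWithinAt (s := U))
        (fun z hz => (⟨hu, hz⟩ : (u, z) ∈ Icc a b ×ˢ U))).hasFDerivAt (hU.mem_nhds hy)
    have hD := fun p hp => hasFDerivWithinAt_timePrimitive hab.le hU hF.continuousOn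
      hF'.continuousOn hd (p := p) hp
    rw [contDiffOn_succ_iff_fderivWithin hS]
    refine ⟨fun p hp => (hD p hp).differentiableWithinAt, by simp, ?_⟩
    have hFn : ContDiffOn ℝ n F (Icc a b ×ˢ U) := hF.of_le (by simp)
    refine ContDiffOn.congr (f := fun p => (timePrimitive a F' p).comp
        (ContinuousLinearMap.snd ℝ ℝ E) + (ContinuousLinearMap.fst ℝ ℝ E).smulRight (F p))
      ?_ (fun p hp => (hD p hp).fderivWithin (hS p hp))
    exact ((ih hF').clm_comp contDiffOn_const).add (contDiffOn_const.smulRight hFn)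

lemma contDiffOn_timePrimitive (hab : a < b) (hU : IsOpen U)
    (hF : ContDiffOn ℝ ∞ F (Icc a b ×ˢ U)) :
    ContDiffOn ℝ ∞ (timePrimitive a F) (Icc a b ×ˢ U) :=
  contDiffOn_infty.mpr fun n => contDiffOn_timePrimitive_nat hab hU n (contDiffOn_infty.mp hF n)

end Primitive

/-- Every smooth function on `[u₁, u₂] × S²` has a smooth time primitive. -/
lemma timeDeriv_integral {u₁ u₂ : ℝ} (h12 : u₁ < u₂) {f : ℝ → S2 → ℝ} (hf : SmoothOn u₁ u₂ f) :
    TimeDeriv u₁ u₂ (fun u x => ∫ v in u₁..u, f v x) f := by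
  refine ⟨SmoothOn.of_contDiffOn
    (contDiffOn_timePrimitive h12 isOpen_compl_singleton hf.contDiffOn) ?_, hf, ?_⟩
  · intro u _ x
    exact intervalIntegral.integral_congr fun v _ => (radialExt_self (f v) x).symm
  · intro u hu x
    have hc : ContinuousOn (fun v => f v x) (Icc u₁ u₂) := by
      refine (continuousOn_slice hf.contDiffOn.continuousOn (coe_ne_zero x)).congr fun v _ => ?_
      exact (radialExt_self (f v) x).symm
    have hi : IntervalIntegrable (fun v => f v x) MeasureTheory.volume u₁ u :=
      (hc.mono (uIcc_subset_Icc ⟨le_rfl, h12.le⟩ hu)).intervalIntegrable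
    -- The one-sided fundamental theorem of calculus on `Icc` takes this membership as an instance.
    have : Fact (u ∈ Icc u₁ u₂) := ⟨hu⟩
    exact intervalIntegral.integral_hasDerivWithinAt_right hi
      (hc.stronglyMeasurableAtFilter_nhdsWithin measurableSet_Icc u) (hc u hu)

/-! ### Integration by parts on the sphere -/

section Integral

open MeasureTheory

variable {f g : S2 → ℝ}

lemma Smooth.integrable (hf : Smooth f) :
    Integrable f (volume : Measure E3).toSphere := by
  have : CompactSpace S2 := inferInstance
  exact hf.continuous.integrable_of_hasCompactSupport (HasCompactSupport.of_compactSpace f)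

lemma sphereIntegral_add (hf : Smooth f) (hg : Smooth g) :
    sphereIntegral (fun x => f x + g x) = sphereIntegral f + sphereIntegral g :=
  integral_add hf.integrable hg.integrable

lemma sphereIntegral_sub (hf : Smooth f) (hg : Smooth g) :
    sphereIntegral (fun x => f x - g x) = sphereIntegral f - sphereIntegral g :=
  integral_sub hf.integrable hg.integrable

lemma sphereIntegral_const_mul (c : ℝ) (f : S2 → ℝ) :
    sphereIntegral (fun x => c * f x) = c * sphereIntegral f :=
  integral_const_mul c f

lemma sphereIntegral_sum {f : Fin 3 → S2 → ℝ} (hf : ∀ i, Smooth (f i)) :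
    sphereIntegral (fun x => ∑ i, f i x) = ∑ i, sphereIntegral (f i) :=
  integral_finsetSum _ fun i _ => (hf i).integrable

/-- A fixed bump function with support in `(0, ∞)`. -/
def radialBump : ContDiffBump (2 : ℝ) := ⟨1 / 2, 1, by norm_num, by norm_num⟩

/-- A radial cut-off function on `ℝ³` supported away from the origin. -/
def cutoff (y : E3) : ℝ := radialBump (‖y‖ ^ 2)

lemma contDiff_cutoff : ContDiff ℝ ∞ cutoff :=
  radialBump.contDiff.comp (contDiff_norm_sq ℝ)

lemma tsupport_cutoff : tsupport cutoff ⊆ {y : E3 | 1 ≤ ‖y‖ ^ 2 ∧ ‖y‖ ^ 2 ≤ 3} := by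
  refine closure_minimal ?_ ?_
  · intro y hy
    have : ‖y‖ ^ 2 ∈ Function.support radialBump := hy
    rw [radialBump.support_eq, Metric.mem_ball, Real.dist_eq, abs_lt] at this
    simp only [radialBump] at this
    constructor <;> linarith [this.1, this.2]
  · have h : Continuous fun y : E3 => ‖y‖ ^ 2 := by fun_prop
    exact (isClosed_le continuous_const h).inter (isClosed_le h continuous_const)

lemma tsupport_cutoff_subset : tsupport cutoff ⊆ {0}ᶜ := by
  intro y hy h0
  have := (tsupport_cutoff hy).1
  rw [mem_singleton_iff] at h0
  norm_num [h0] at this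

lemma hasCompactSupport_cutoff : HasCompactSupport cutoff := by
  refine HasCompactSupport.of_support_subset_isCompact (isCompact_closedBall (0 : E3) 2) ?_
  intro y hy
  have := (tsupport_cutoff (subset_tsupport _ hy)).2
  rw [mem_closedBall_zero_iff]
  nlinarith [norm_nonneg y]

lemma integrable_mul_of_tsupport {Q k : E3 → ℝ} (hQ : Continuous Q) (hc : HasCompactSupport Q)
    (hs : tsupport Q ⊆ {0}ᶜ) (hk : ContinuousOn k {0}ᶜ) : Integrable (fun y => Q y * k y) := by
  refine Continuous.integrable_of_hasCompactSupport (continuous_of_tsupport fun y hy => ?_)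
    hc.mul_right
  have hy' : y ∈ ({0}ᶜ : Set E3) := hs (closure_mono (Function.support_mul_subset_left Q k) hy)
  exact hQ.continuousAt.mul (hk.continuousAt (isOpen_compl_singleton.mem_nhds hy'))

/-- The radial factor of the integral of a cut-off function in polar coordinates. -/
def radialFactor : ℝ := ∫ r : Ioi (0 : ℝ), radialBump ((r : ℝ) ^ 2) ∂(Measure.volumeIoiPow 2)

/-- In polar coordinates the cut-off depends on the radius only and the extension on the direction
only. This carries integration by parts from `ℝ³` to the sphere. -/
lemma integral_cutoff_mul (k : S2 → ℝ) :
    ∫ y, cutoff y * radialExt k y = sphereIntegral k * radialFactor := by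
  have hd : Module.finrank ℝ E3 - 1 = 2 := by simp
  calc ∫ y, cutoff y * radialExt k y
      = ∫ y : ({0}ᶜ : Set E3), cutoff y * radialExt k y
          ∂((volume : Measure E3).comap (fun y : ({0}ᶜ : Set E3) => (y : E3))) := by
        rw [integral_subtype_comap (measurableSet_singleton _).compl
          fun y : E3 => cutoff y * radialExt k y, restrict_compl_singleton]
    _ = ∫ p, k p.1 * radialBump ((p.2 : ℝ) ^ 2)
          ∂((volume : Measure E3).toSphere.prod (.volumeIoiPow (Module.finrank ℝ E3 - 1))) := by
        rw [← (volume : Measure E3).measurePreserving_homeomorphUnitSphereProd.integral_comp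
          (Homeomorph.measurableEmbedding _)]
        refine integral_congr_ae (Filter.Eventually.of_forall fun y => ?_)
        simp only [cutoff, radialExt_eq k y.2, homeomorphUnitSphereProd_apply_snd_coe]
        rw [mul_comm]
        congr 2
        apply Subtype.ext
        rw [retraction_coe y.2]; simp
    _ = sphereIntegral k * radialFactor := by
        rw [hd, integral_prod_mul (fun x => k x) fun r : Ioi (0 : ℝ) => radialBump ((r : ℝ) ^ 2)]
        rfl

lemma radialFactor_ne_zero : radialFactor ≠ 0 := by
  intro h
  have h1 := integral_cutoff_mul (fun _ => 1)
  rw [h, mul_zero] at h1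
  have h2 : ∫ y, cutoff y = 0 := by
    rw [← h1]
    refine integral_congr_ae ?_
    filter_upwards [compl_mem_ae_iff.mpr (measure_singleton (0 : E3))] with y hy
    rw [radialExt_eq _ hy, mul_one]
  have h3 : 0 < ∫ y, cutoff y := by
    refine contDiff_cutoff.continuous.integral_pos_of_hasCompactSupport_nonneg_nonzero
      -- At a vector of length `√2` the squared norm is the centre `2` of the bump.
      hasCompactSupport_cutoff (fun y => radialBump.nonneg) (x := √2 • EuclideanSpace.single 0 1) ?_
    have : ‖√2 • EuclideanSpace.single (0 : Fin 3) (1 : ℝ)‖ ^ 2 = 2 := by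
      rw [norm_smul, mul_pow]; simp
    rw [cutoff, this]
    exact (radialBump.pos_of_mem_ball (by simp [radialBump])).ne'
  linarith

/-- After integration by parts the derivative falls on `χ(‖y‖²) y_a`, and `∂_b (χ y_a) = χ δ_ab + 2
χ' y_a y_b` is symmetric in `a` and `b`. -/
lemma integral_cutoff_mul_coord_mul_fderiv (hf : Smooth f) (a b : Fin 3) :
    ∫ y, cutoff y * y a * fderiv ℝ (radialExt f) y (EuclideanSpace.single b 1)
      = ∫ y, cutoff y * y b * fderiv ℝ (radialExt f) y (EuclideanSpace.single a 1) := by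
  have hP : ∀ a : Fin 3, ContDiff ℝ ∞ (fun y : E3 => cutoff y * y a) := fun a =>
    contDiff_cutoff.mul (by fun_prop)
  have hPc : ∀ a : Fin 3, HasCompactSupport (fun y : E3 => cutoff y * y a) := fun a =>
    hasCompactSupport_cutoff.mul_right
  have hPs : ∀ a : Fin 3, tsupport (fun y : E3 => cutoff y * y a) ⊆ {0}ᶜ := fun a =>
    (closure_mono (Function.support_mul_subset_left _ _)).trans tsupport_cutoff_subset
  have hk : ContinuousOn (radialExt f) {0}ᶜ := fun y hy =>
    (hf.contDiffAt hy).continuousAt.continuousWithinAt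
  have hk' : ∀ b, ContinuousOn
      (fun y => fderiv ℝ (radialExt f) y (EuclideanSpace.single b 1)) {0}ᶜ := fun b y hy =>
    (((hf.contDiffAt hy).fderiv_right (m := ∞) (by simp)).continuousAt.clm_apply
      continuousAt_const).continuousWithinAt
  have key : ∀ a b : Fin 3,
      ∫ y, cutoff y * y a * fderiv ℝ (radialExt f) y (EuclideanSpace.single b 1)
        = - ∫ y, fderiv ℝ (fun y : E3 => cutoff y * y a) y (EuclideanSpace.single b 1)
            * radialExt f y := by
    intro a b
    have hQ : Continuous
        (fun y => fderiv ℝ (fun y : E3 => cutoff y * y a) y (EuclideanSpace.single b 1)) :=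
      ((hP a).continuous_fderiv (by simp)).clm_apply continuous_const
    exact integral_mul_fderiv_eq_neg_fderiv_mul_of_integrable
      (integrable_mul_of_tsupport hQ ((hPc a).fderiv_apply ℝ _)
        ((tsupport_fderiv_apply_subset ℝ _).trans (hPs a)) hk)
      (integrable_mul_of_tsupport (hP a).continuous (hPc a) (hPs a) (hk' b))
      (integrable_mul_of_tsupport (hP a).continuous (hPc a) (hPs a) hk)
      (fun y _ => (hP a).differentiable (by simp) y)
      (fun y hy => (hf.contDiffAt (hPs a hy)).differentiableAt (by simp))
  rw [key a b, key b a]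
  congr 2
  funext y
  congr 1
  have hc : ∀ b : Fin 3, fderiv ℝ cutoff y (EuclideanSpace.single b 1)
      = deriv radialBump (‖y‖ ^ 2) * (2 * y b) := by
    intro b
    have h1 : HasDerivAt radialBump (deriv radialBump (‖y‖ ^ 2)) (‖y‖ ^ 2) :=
      ((radialBump.contDiff (n := 1)).differentiable (by simp) _).hasDerivAt
    have h2 := h1.comp_hasFDerivAt y (hasStrictFDerivAt_norm_sq y).hasFDerivAt
    have h3 : fderiv ℝ cutoff y = _ := h2.fderiv
    rw [h3]
    simp [EuclideanSpace.inner_single_right]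
  have hm : ∀ a b : Fin 3, fderiv ℝ (fun y : E3 => cutoff y * y a) y (EuclideanSpace.single b 1)
      = cutoff y * (if a = b then 1 else 0) + y a * (deriv radialBump (‖y‖ ^ 2) * (2 * y b)) := by
    intro a b
    have h1 : HasFDerivAt (fun y : E3 => y a) (EuclideanSpace.proj a : E3 →L[ℝ] ℝ) y :=
      (EuclideanSpace.proj a : E3 →L[ℝ] ℝ).hasFDerivAt
    have h2 := ((contDiff_cutoff.differentiable (by simp) y).hasFDerivAt.mul h1).fderiv
    have h3 : fderiv ℝ (fun y : E3 => cutoff y * y a) y = _ := h2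
    rw [h3]
    simp [hc]
  rw [hm, hm]
  simp only [eq_comm (a := a)]
  ring

/-- The generators of rotations integrate to zero. -/
lemma sphereIntegral_rotation (hf : Smooth f) (a b : Fin 3) :
    sphereIntegral (fun x => coord a x * partialDeriv b f x - coord b x * partialDeriv a f x)
      = 0 := by
  have hD : ∀ b, Smooth (partialDeriv b f) := fun b => smooth_partialDeriv b hf
  -- `y_a` has degree `1` and the derivative degree `-1`, so their product is the radial extension
  -- of `x_a ∂_b f`.
  have e : ∀ a b : Fin 3, ∫ y, cutoff y * y a * fderiv ℝ (radialExt f) y (EuclideanSpace.single b 1)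
      = sphereIntegral (fun x => coord a x * partialDeriv b f x) * radialFactor := by
    intro a b
    rw [← integral_cutoff_mul]
    refine integral_congr_ae ?_
    filter_upwards [compl_mem_ae_iff.mpr (measure_singleton (0 : E3))] with y hy
    have hy0 : y ≠ 0 := hy
    have hy' := norm_pos_iff.mpr hy0
    have h1 := radialExt_partialDeriv b hf hy0
    rw [radialExt_eq _ hy0] at h1 ⊢
    rw [h1, coord, retraction_coe hy0]
    simp only [PiLp.smul_apply, smul_eq_mul]
    field_simp
  rw [sphereIntegral_sub ((smooth_coord a).mul (hD b)) ((smooth_coord b).mul (hD a))]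
  have := integral_cutoff_mul_coord_mul_fderiv hf a b
  rw [e, e] at this
  rw [mul_right_cancel₀ radialFactor_ne_zero this, sub_self]

/-- The divergence theorem for the derivations `∂_b`; the mean curvature of the sphere is `2`. -/
lemma sphereIntegral_partialDeriv (hf : Smooth f) (b : Fin 3) :
    sphereIntegral (partialDeriv b f) = 2 * sphereIntegral (fun x => coord b x * f x) := by
  have hx := smooth_coord
  have hD : ∀ b, Smooth (partialDeriv b f) := fun b => smooth_partialDeriv b hf
  have hL : ∀ a, Smooth (fun x => coord a x * partialDeriv b (fun y => coord a y * f y) x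
      - coord b x * partialDeriv a (fun y => coord a y * f y) x) := fun a =>
    ((hx a).mul (smooth_partialDeriv b ((hx a).mul hf))).sub
      ((hx b).mul (smooth_partialDeriv a ((hx a).mul hf)))
  -- With `L_ab = x_a ∂_b - x_b ∂_a` this is `∂_b f = ∑ L_ab (x_a f) + 2 x_b f`; the `2` is the
  -- trace of `σ`.
  have e : partialDeriv b f = fun x =>
      (∑ a, (coord a x * partialDeriv b (fun y => coord a y * f y) x
        - coord b x * partialDeriv a (fun y => coord a y * f y) x)) + 2 * (coord b x * f x) := by
    funext x
    have h1 := sum_coord_sq x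
    have h2 := sum_coord_mul_partialDeriv hf x
    simp only [partialDeriv_mul _ (hx _) hf, partialDeriv_coord]
    simp only [metric, coord, Fin.sum_univ_three] at h1 h2 ⊢
    fin_cases b <;> simp
    · linear_combination (-(partialDeriv 0 f x)) * h1 + (x : E3) 0 * h2
    · linear_combination (-(partialDeriv 1 f x)) * h1 + (x : E3) 1 * h2
    · linear_combination (-(partialDeriv 2 f x)) * h1 + (x : E3) 2 * h2
  rw [e, sphereIntegral_add (Smooth.sum hL) ((smooth_const 2).mul ((hx b).mul hf)),
    sphereIntegral_sum hL, sphereIntegral_const_mul]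
  simp [sphereIntegral_rotation ((hx _).mul hf)]

end Integral

/-! ### Tensor calculus in terms of the derivations `∂_a` -/

section Metric
variable (x : S2)

lemma sum_metric_mul {v : Fin 3 → ℝ} (hv : ∑ i, (x : E3) i * v i = 0) (i : Fin 3) :
    ∑ a, metric x i a * v a = v i := by
  simp only [metric, Fin.sum_univ_three] at hv ⊢
  fin_cases i <;> simp
  · linear_combination -(x : E3) 0 * hv
  · linear_combination -(x : E3) 1 * hv
  · linear_combination -(x : E3) 2 * hv

lemma metric_symm (i j : Fin 3) : metric x i j = metric x j i := by
  simp only [metric, eq_comm (a := i)]; ring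

lemma sum_metric_mul' {v : Fin 3 → ℝ} (hv : ∑ i, (x : E3) i * v i = 0) (i : Fin 3) :
    ∑ a, metric x a i * v a = v i := by
  simpa only [metric_symm x i] using sum_metric_mul x hv i

end Metric

lemma grad_eq {f : S2 → ℝ} (hf : Smooth f) (x : S2) (i : Fin 3) :
    grad f x i = partialDeriv i f x :=
  sum_metric_mul x (sum_coord_mul_partialDeriv hf x) i

/-- A one-form with smooth components. -/
abbrev SmoothForm (w : S2 → Fin 3 → ℝ) : Prop := ∀ i, Smooth (fun x => w x i)

/-- A 2-tensor with smooth components. -/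
abbrev SmoothTensor (T : S2 → Fin 3 → Fin 3 → ℝ) : Prop := ∀ i j, Smooth (fun x => T x i j)

lemma smoothForm_grad {f : S2 → ℝ} (hf : Smooth f) : SmoothForm (grad f) := fun i => by
  simpa only [grad_eq hf] using smooth_partialDeriv i hf

/-- Differentiate `x·w = 0`. -/
lemma sum_coord_mul_partialDeriv_form {w : S2 → Fin 3 → ℝ} (hw : SmoothForm w)
    (ht : IsOneForm w) (a : Fin 3) (x : S2) :
    ∑ b, (x : E3) b * partialDeriv a (fun y => w y b) x = - w x a := by
  have h0 : (fun y : S2 => ∑ b, coord b y * w y b) = fun _ => 0 := funext ht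
  have h1 := partialDeriv_const a 0 x
  rw [← h0, partialDeriv_sum a (fun b => (smooth_coord b).mul (hw b))] at h1
  simp only [partialDeriv_mul a (smooth_coord _) (hw _), partialDeriv_coord,
    Finset.sum_add_distrib, sum_metric_mul x (ht x) a] at h1
  simp only [coord] at h1
  linarith

/-- The projector on the first slot is idle by Euler's identity; the one on the second removes the
normal component `-w_i`, which adds `x_j w_i`. -/
lemma covD1_eq {w : S2 → Fin 3 → ℝ} (hw : SmoothForm w) (ht : IsOneForm w) (x : S2)
    (i j : Fin 3) :
    covD1 w x i j = partialDeriv i (fun y => w y j) x + (x : E3) j * w x i := by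
  have h1 : covD1 w x i j = ∑ b, metric x j b * partialDeriv i (fun y => w y b) x := by
    rw [covD1, Finset.sum_comm]
    refine Finset.sum_congr rfl fun b _ => ?_
    rw [← sum_metric_mul x (sum_coord_mul_partialDeriv (hw b) x) i, Finset.mul_sum]
    exact Finset.sum_congr rfl fun a _ => by ring
  have h2 := sum_coord_mul_partialDeriv_form hw ht i x
  rw [h1]
  simp only [metric, Fin.sum_univ_three] at h2 ⊢
  fin_cases j <;> simp
  · linear_combination -(x : E3) 0 * h2
  · linear_combination -(x : E3) 1 * h2
  · linear_combination -(x : E3) 2 * h2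

lemma div1_eq {w : S2 → Fin 3 → ℝ} (hw : SmoothForm w) (ht : IsOneForm w) (x : S2) :
    div1 w x = ∑ i, partialDeriv i (fun y => w y i) x := by
  simp only [div1, covD1_eq hw ht, Finset.sum_add_distrib, ht x, add_zero]

/-- The divergence `∂_b T_bj` in Cartesian components. -/
def cartDiv (T : S2 → Fin 3 → Fin 3 → ℝ) (x : S2) (j : Fin 3) : ℝ :=
  ∑ b, partialDeriv b (fun y => T y b j) x

/-- A 2-tensor without normal components in its second slot. -/
def TangentRight (T : S2 → Fin 3 → Fin 3 → ℝ) : Prop :=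
  ∀ x : S2, ∀ i, ∑ j, (x : E3) j * T x i j = 0

lemma sum_coord_mul_cartDiv {T : S2 → Fin 3 → Fin 3 → ℝ} (hT : SmoothTensor T)
    (ht : TangentRight T) (x : S2) :
    ∑ c, (x : E3) c * cartDiv T x c = - ∑ b, T x b b := by
  simp only [cartDiv, Finset.mul_sum]
  rw [Finset.sum_comm, ← Finset.sum_neg_distrib]
  exact Finset.sum_congr rfl fun b _ =>
    sum_coord_mul_partialDeriv_form (hT b) (fun y => ht y b) b x

/-- The projectors on the contracted slots combine into one, idle by Euler's identity. The projector
on `j` is idle because the normal component of `cartDiv T` is minus the trace, assumed zero. -/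
lemma div2_eq {T : S2 → Fin 3 → Fin 3 → ℝ} (hT : SmoothTensor T)
    (ht : TangentRight T) (x : S2) (j : Fin 3) (htr : ∑ b, T x b b = 0) :
    div2 T x j = cartDiv T x j := by
  have h1 : div2 T x j = ∑ c, metric x j c * cartDiv T x c := by
    simp only [div2, covD2, cartDiv, Finset.mul_sum]
    have h2 : ∀ b c, ∑ i, ∑ a, metric x i a * metric x i b * metric x j c *
        partialDeriv a (fun y => T y b c) x
        = metric x j c * partialDeriv b (fun y => T y b c) x := by
      intro b c
      have h3 := sum_coord_mul_partialDeriv (hT b c) x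
      rw [← sum_metric_mul' x h3 b, Finset.mul_sum]
      refine Finset.sum_congr rfl fun i _ => ?_
      rw [← sum_metric_mul x h3 i, Finset.mul_sum, Finset.mul_sum]
      exact Finset.sum_congr rfl fun a _ => by ring
    rw [Finset.sum_comm' (s := Finset.univ) (t := fun _ => Finset.univ) (t' := Finset.univ)
      (s' := fun _ => Finset.univ) (by simp)]
    simp only [← h2]
    simp only [Fin.sum_univ_three]
    ring
  rw [h1]
  refine sum_metric_mul x ?_ j
  rw [sum_coord_mul_cartDiv hT ht, htr, neg_zero]

/-- The curl `∇_i w_j - ∇_j w_i` of a one-form in Cartesian components. -/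
def cartCurl (w : S2 → Fin 3 → ℝ) (x : S2) (i j : Fin 3) : ℝ :=
  partialDeriv i (fun y => w y j) x + coord j x * w x i
    - (partialDeriv j (fun y => w y i) x + coord i x * w x j)

/-- The double divergence in Cartesian components. -/
def cartDivDiv (T : S2 → Fin 3 → Fin 3 → ℝ) (x : S2) : ℝ :=
  ∑ a, partialDeriv a (fun y => cartDiv T y a) x

/-- The divergence of the curl of the divergence in Cartesian components. -/
def cartDivCurlDiv (T : S2 → Fin 3 → Fin 3 → ℝ) : S2 → Fin 3 → ℝ :=
  cartDiv (cartCurl (cartDiv T))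

/-! ### Smoothness and linearity of the Cartesian operators -/

section Smoothness
variable {T S : S2 → Fin 3 → Fin 3 → ℝ} {w v : S2 → Fin 3 → ℝ}

lemma smoothForm_cartDiv (hT : SmoothTensor T) : SmoothForm (cartDiv T) := fun j =>
  Smooth.sum fun b => smooth_partialDeriv b (hT b j)

lemma smoothTensor_cartCurl (hw : SmoothForm w) : SmoothTensor (cartCurl w) := fun i j =>
  ((smooth_partialDeriv i (hw j)).add ((smooth_coord j).mul (hw i))).sub
    ((smooth_partialDeriv j (hw i)).add ((smooth_coord i).mul (hw j)))

lemma smooth_cartDivDiv (hT : SmoothTensor T) : Smooth (cartDivDiv T) :=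
  Smooth.sum fun a => smooth_partialDeriv a (smoothForm_cartDiv hT a)

lemma smoothForm_cartDivCurlDiv (hT : SmoothTensor T) : SmoothForm (cartDivCurlDiv T) :=
  smoothForm_cartDiv (smoothTensor_cartCurl (smoothForm_cartDiv hT))

lemma cartDiv_sub (hS : SmoothTensor S) (hT : SmoothTensor T) :
    cartDiv (fun x i j => S x i j - T x i j) = fun x j => cartDiv S x j - cartDiv T x j := by
  funext x j
  simp only [cartDiv, partialDeriv_sub _ (hS _ _) (hT _ _), Finset.sum_sub_distrib]

lemma cartCurl_sub (hw : SmoothForm w) (hv : SmoothForm v) :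
    cartCurl (fun x i => w x i - v x i) = fun x i j => cartCurl w x i j - cartCurl v x i j := by
  funext x i j
  simp only [cartCurl, partialDeriv_sub _ (hw _) (hv _)]
  ring

lemma cartDivDiv_sub (hS : SmoothTensor S) (hT : SmoothTensor T) (x : S2) :
    cartDivDiv (fun x i j => S x i j - T x i j) x = cartDivDiv S x - cartDivDiv T x := by
  simp only [cartDivDiv, cartDiv_sub hS hT,
    partialDeriv_sub _ (smoothForm_cartDiv hS _) (smoothForm_cartDiv hT _),
    Finset.sum_sub_distrib]

lemma cartDivCurlDiv_sub (hS : SmoothTensor S) (hT : SmoothTensor T) (x : S2) (j : Fin 3) :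
    cartDivCurlDiv (fun x i j => S x i j - T x i j) x j
      = cartDivCurlDiv S x j - cartDivCurlDiv T x j := by
  have hS' := smoothForm_cartDiv hS
  have hT' := smoothForm_cartDiv hT
  simp only [cartDivCurlDiv, cartDiv_sub hS hT, cartCurl_sub hS' hT',
    cartDiv_sub (smoothTensor_cartCurl hS') (smoothTensor_cartCurl hT')]

end Smoothness

/-! ### Commutation of the Cartesian operators with `∂_u` -/

section TimeDerivatives
variable {u₁ u₂ : ℝ} {T T' : ℝ → S2 → Fin 3 → Fin 3 → ℝ}

lemma TimeDeriv.cartDiv (h12 : u₁ < u₂)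
    (h : ∀ i j, TimeDeriv u₁ u₂ (fun u x => T u x i j) (fun u x => T' u x i j)) (j : Fin 3) :
    TimeDeriv u₁ u₂ (fun u x => cartDiv (T u) x j) (fun u x => cartDiv (T' u) x j) :=
  TimeDeriv.sum fun b => (h b j).partialDeriv h12 b

lemma TimeDeriv.cartCurl {w w' : ℝ → S2 → Fin 3 → ℝ} (h12 : u₁ < u₂)
    (h : ∀ i, TimeDeriv u₁ u₂ (fun u x => w u x i) (fun u x => w' u x i)) (i j : Fin 3) :
    TimeDeriv u₁ u₂ (fun u x => cartCurl (w u) x i j) (fun u x => cartCurl (w' u) x i j) :=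
  (((h j).partialDeriv h12 i).add ((h i).smooth_mul (smooth_coord j))).sub
    (((h i).partialDeriv h12 j).add ((h j).smooth_mul (smooth_coord i)))

lemma TimeDeriv.cartDivDiv (h12 : u₁ < u₂)
    (h : ∀ i j, TimeDeriv u₁ u₂ (fun u x => T u x i j) (fun u x => T' u x i j)) :
    TimeDeriv u₁ u₂ (fun u => cartDivDiv (T u)) (fun u => cartDivDiv (T' u)) :=
  TimeDeriv.sum fun a => (TimeDeriv.cartDiv h12 h a).partialDeriv h12 a

lemma TimeDeriv.cartDivCurlDiv (h12 : u₁ < u₂)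
    (h : ∀ i j, TimeDeriv u₁ u₂ (fun u x => T u x i j) (fun u x => T' u x i j)) (j : Fin 3) :
    TimeDeriv u₁ u₂ (fun u x => cartDivCurlDiv (T u) x j)
      (fun u x => cartDivCurlDiv (T' u) x j) :=
  TimeDeriv.cartDiv h12 (TimeDeriv.cartCurl h12 (TimeDeriv.cartDiv h12 h)) j

end TimeDerivatives

/-! ### Covariant operators on symmetric traceless tensors -/

section SymTraceless
variable {T : S2 → Fin 3 → Fin 3 → ℝ} {w : S2 → Fin 3 → ℝ}

lemma IsSymTraceless.symm (h : IsSymTraceless T) (x : S2) (i j : Fin 3) : T x i j = T x j i :=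
  (h x).2.1 i j

lemma IsSymTraceless.tangentRight (h : IsSymTraceless T) : TangentRight T := fun x i => by
  simpa only [h.symm x i] using (h x).1 i

lemma IsSymTraceless.div2_eq (h : IsSymTraceless T) (hT : SmoothTensor T) :
    div2 T = cartDiv T :=
  funext fun x => funext fun j => NullInfinity.div2_eq hT h.tangentRight x j (h x).2.2

lemma IsSymTraceless.isOneForm_cartDiv (h : IsSymTraceless T) (hT : SmoothTensor T) :
    IsOneForm (cartDiv T) := fun x => by
  rw [sum_coord_mul_cartDiv hT h.tangentRight, (h x).2.2, neg_zero]

lemma cartCurl_antisymm (w : S2 → Fin 3 → ℝ) (x : S2) (i j : Fin 3) :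
    cartCurl w x i j = - cartCurl w x j i := by
  simp only [cartCurl]; ring

/-- `x_j ∂_i w_j = -w_i` is cancelled by `|x|² w_i`, which comes from the zeroth-order terms of
`cartCurl`. -/
lemma tangentRight_cartCurl (hw : SmoothForm w) (ht : IsOneForm w) :
    TangentRight (cartCurl w) := fun x i => by
  have h1 := sum_coord_mul_partialDeriv_form hw ht i x
  have h2 := sum_coord_mul_partialDeriv (hw i) x
  have h3 := ht x
  have h4 := sum_coord_sq x
  simp only [cartCurl, coord, Fin.sum_univ_three] at h1 h2 h3 h4 ⊢
  linear_combination h1 - h2 + w x i * h4 - (x : E3) i * h3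

lemma tangentLeft_cartCurl (hw : SmoothForm w) (ht : IsOneForm w) (x : S2) (j : Fin 3) :
    ∑ i, (x : E3) i * cartCurl w x i j = 0 := by
  simp only [cartCurl_antisymm w x _ j, mul_neg, Finset.sum_neg_distrib,
    tangentRight_cartCurl hw ht x j, neg_zero]

lemma IsSymTraceless.div1_div2_eq (h : IsSymTraceless T) (hT : SmoothTensor T) :
    div1 (div2 T) = cartDivDiv T := by
  rw [h.div2_eq hT]
  exact funext (div1_eq (smoothForm_cartDiv hT) (h.isOneForm_cartDiv hT))

lemma IsSymTraceless.div2_curl_eq (h : IsSymTraceless T) (hT : SmoothTensor T) :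
    div2 (fun y d a => covD1 (div2 T) y d a - covD1 (div2 T) y a d) = cartDivCurlDiv T := by
  have hs := smoothForm_cartDiv hT
  have ht := h.isOneForm_cartDiv hT
  have e : (fun y d a => covD1 (div2 T) y d a - covD1 (div2 T) y a d)
      = cartCurl (cartDiv T) := by
    funext y d a
    rw [h.div2_eq hT, covD1_eq hs ht, covD1_eq hs ht]; rfl
  rw [e]
  funext x j
  refine NullInfinity.div2_eq (smoothTensor_cartCurl hs) (tangentRight_cartCurl hs ht) x j ?_
  exact Finset.sum_eq_zero fun b _ => by
    have := cartCurl_antisymm (cartDiv T) x b b; linarith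

/-- The charges contract the derivative with the second tensor slot, `div2` with the first. -/
lemma IsSymTraceless.sum_covD2_eq (h : IsSymTraceless T) (x : S2) (d : Fin 3) :
    ∑ b, covD2 T x b d b = div2 T x d := by
  refine Finset.sum_congr rfl fun b _ => ?_
  simp only [covD2]
  refine Finset.sum_congr rfl fun a _ => ?_
  rw [Finset.sum_comm]
  refine Finset.sum_congr rfl fun c _ => Finset.sum_congr rfl fun e _ => ?_
  have : (fun y => T y e c) = fun y => T y c e := funext fun y => h.symm y e c
  rw [this]; ring

end SymTraceless

/-! ### The area form and the duality map -/

/-- The Levi-Civita symbol of `ℝ³`. -/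
def leviCivita (i j k : Fin 3) : ℝ :=
  -- A Vandermonde product: it vanishes on repeated indices and equals `2` at `(0, 1, 2)`. Being
  -- polynomial, it lets `ring` prove antisymmetry.
  (((j : ℕ) : ℝ) - (i : ℕ)) * (((k : ℕ) : ℝ) - (i : ℕ)) * (((k : ℕ) : ℝ) - (j : ℕ)) / 2

lemma areaForm_eq (x : S2) (i j : Fin 3) :
    areaForm x i j = ∑ k, leviCivita i j k * (x : E3) k := by
  simp only [areaForm, Matrix.det_fin_three, leviCivita, Fin.sum_univ_three]
  fin_cases i <;> fin_cases j <;> simp <;> norm_num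

lemma areaForm_antisymm (x : S2) (i j : Fin 3) : areaForm x i j = - areaForm x j i := by
  simp only [areaForm_eq, leviCivita, Fin.sum_univ_three]; ring

lemma smooth_areaForm (i j : Fin 3) : Smooth (fun x => areaForm x i j) := by
  simp only [areaForm_eq]
  exact Smooth.sum fun k => (smooth_const _).mul (smooth_coord k)

lemma partialDeriv_areaForm (a i j : Fin 3) (x : S2) :
    partialDeriv a (fun y => areaForm y i j) x = ∑ k, leviCivita i j k * metric x a k := by
  have e : (fun y => areaForm y i j) = fun y => ∑ k, leviCivita i j k * coord k y :=
    funext fun y => areaForm_eq y i j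
  rw [e, partialDeriv_sum a fun k => (smooth_const _).mul (smooth_coord k)]
  exact Finset.sum_congr rfl fun k _ => by
    rw [partialDeriv_const_mul a _ (smooth_coord k), partialDeriv_coord]

lemma sum_coord_mul_areaForm (x : S2) (j : Fin 3) :
    ∑ i, (x : E3) i * areaForm x i j = 0 := by
  simp only [areaForm_eq, leviCivita, Fin.sum_univ_three]
  fin_cases j <;> simp <;> ring

lemma sum_areaForm_mul_areaForm (x : S2) (e f : Fin 3) :
    ∑ d, areaForm x d e * areaForm x d f = metric x e f := by
  have h := sum_coord_sq x
  simp only [areaForm_eq, leviCivita, metric, Fin.sum_univ_three] at h ⊢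
  fin_cases e <;> fin_cases f <;> simp <;> linarith

/-- Rotation by a right angle is an isometry of the tangent plane. -/
lemma sum_rotate_mul_rotate (x : S2) {v w : Fin 3 → ℝ} (hw : ∑ i, (x : E3) i * w i = 0) :
    ∑ d, (∑ e, areaForm x d e * v e) * (∑ f, areaForm x d f * w f) = ∑ e, v e * w e := by
  have h1 : ∀ e, ∑ f, (∑ d, areaForm x d e * areaForm x d f) * w f = w e := fun e => by
    simp only [sum_areaForm_mul_areaForm]; exact sum_metric_mul x hw e
  calc ∑ d, (∑ e, areaForm x d e * v e) * (∑ f, areaForm x d f * w f)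
      = ∑ e, v e * ∑ f, (∑ d, areaForm x d e * areaForm x d f) * w f := by
        simp only [Fin.sum_univ_three]; ring
    _ = ∑ e, v e * w e := by simp only [h1]

/-- The antisymmetric part of `ε_i^d t_dj` for a symmetric tangential tensor. -/
lemma rotate_sub_rotate (x : S2) {t : Fin 3 → Fin 3 → ℝ} (ht : ∀ j, ∑ i, (x : E3) i * t i j = 0)
    (hs : ∀ i j, t i j = t j i) (i j : Fin 3) :
    ∑ d, areaForm x i d * t d j - ∑ d, areaForm x j d * t d i = areaForm x i j * ∑ d, t d d := by
  have h0 := ht 0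
  have h1 := ht 1
  have h2 := ht 2
  have s1 := hs 1 0
  have s2 := hs 2 0
  have s3 := hs 2 1
  simp only [areaForm_eq, leviCivita, Fin.sum_univ_three] at h0 h1 h2 ⊢
  fin_cases i <;> fin_cases j <;> simp
  · linear_combination -h2 - (x : E3) 1 * s3 - (x : E3) 0 * s2
  · linear_combination h1 - (x : E3) 2 * s3 + (x : E3) 0 * s1
  · linear_combination h2 + (x : E3) 1 * s3 + (x : E3) 0 * s2
  · linear_combination -h0 + (x : E3) 1 * s1 + (x : E3) 2 * s2
  · linear_combination -h1 + (x : E3) 2 * s3 - (x : E3) 0 * s1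
  · linear_combination h0 - (x : E3) 1 * s1 - (x : E3) 2 * s2

section Duality
variable {S T : S2 → Fin 3 → Fin 3 → ℝ}

lemma IsSymTraceless.eps2_symm (h : IsSymTraceless T) (x : S2) (i j : Fin 3) :
    eps2 T x i j = eps2 T x j i := by
  have := rotate_sub_rotate x (h x).1 (h x).2.1 i j
  rw [(h x).2.2, mul_zero] at this
  exact sub_eq_zero.mp this

lemma IsSymTraceless.eps2 (h : IsSymTraceless T) : IsSymTraceless (eps2 T) := fun x => by
  refine ⟨fun j => ?_, h.eps2_symm x, ?_⟩
  · have h1 := sum_coord_mul_areaForm x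
    calc ∑ i, (x : E3) i * NullInfinity.eps2 T x i j
        = ∑ d, (∑ i, (x : E3) i * areaForm x i d) * T x d j := by
          simp only [NullInfinity.eps2, Fin.sum_univ_three]; ring
      _ = 0 := by simp only [h1, zero_mul, Finset.sum_const_zero]
  · have s1 := h.symm x 1 0
    have s2 := h.symm x 2 0
    have s3 := h.symm x 2 1
    simp only [NullInfinity.eps2, areaForm_eq, leviCivita, Fin.sum_univ_three]
    simp
    linear_combination (x : E3) 2 * s1 - (x : E3) 1 * s2 + (x : E3) 0 * s3

lemma IsSymTraceless.sub (hS : IsSymTraceless S) (hT : IsSymTraceless T) :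
    IsSymTraceless (fun x i j => S x i j - T x i j) := fun x => by
  refine ⟨fun j => ?_, fun i j => ?_, ?_⟩
  · simp only [mul_sub, Finset.sum_sub_distrib, (hS x).1 j, (hT x).1 j, sub_zero]
  · simp only [hS.symm x i j, hT.symm x i j]
  · simp only [Finset.sum_sub_distrib, (hS x).2.2, (hT x).2.2, sub_zero]

lemma smoothTensor_eps2 (hT : SmoothTensor T) : SmoothTensor (eps2 T) := fun i j =>
  Smooth.sum fun d => (smooth_areaForm i d).mul (hT d j)

lemma inner2_eps2 (S : S2 → Fin 3 → Fin 3 → ℝ) (hT : IsSymTraceless T) :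
    inner2 (eps2 S) (eps2 T) = inner2 S T := by
  funext x
  simp only [inner2]
  rw [Finset.sum_comm, Finset.sum_comm (f := fun i j => S x i j * T x i j)]
  exact Finset.sum_congr rfl fun j _ => sum_rotate_mul_rotate x ((hT x).1 j)

/-- By symmetry of `ε₂(S)` the rotation may act on the contracted index, where it meets the rotation
of `v` and cancels by isometry. -/
lemma IsSymTraceless.sum_eps2_mul_rotate (hS : IsSymTraceless S) (x : S2) {v : Fin 3 → ℝ}
    (hv : ∑ i, (x : E3) i * v i = 0) (i : Fin 3) :
    ∑ b, NullInfinity.eps2 S x i b * (∑ d, areaForm x b d * v d) = ∑ b, S x i b * v b := by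
  have e : ∀ b, NullInfinity.eps2 S x i b = ∑ d, areaForm x b d * S x d i := fun b =>
    hS.eps2_symm x i b
  simp only [e, sum_rotate_mul_rotate x hv]
  exact Finset.sum_congr rfl fun b _ => by rw [hS.symm x b i]

/-- The Cartesian form of `∇ε = 0`: the rotation may act on the free index, and the derivative of
`ε` only yields the Levi-Civita symbol contracted with the symmetric `T`. -/
lemma cartDiv_eps2 (hT : IsSymTraceless T) (hs : SmoothTensor T) (x : S2) (j : Fin 3) :
    cartDiv (eps2 T) x j = ∑ d, areaForm x j d * cartDiv T x d := by
  have e : ∀ b, (fun y => eps2 T y b j) = fun y => ∑ d, areaForm y j d * T y d b := fun b =>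
    funext fun y => hT.eps2_symm y b j
  have e2 : ∀ b d, (fun y => T y d b) = fun y => T y b d := fun b d =>
    funext fun y => hT.symm y d b
  have h1 : ∀ b, partialDeriv b (fun y => eps2 T y b j) x
      = ∑ d, ((∑ k, leviCivita j d k * metric x b k) * T x d b
        + areaForm x j d * partialDeriv b (fun y => T y b d) x) := fun b => by
    rw [e b, partialDeriv_sum b fun d => (smooth_areaForm j d).mul (hs d b)]
    refine Finset.sum_congr rfl fun d _ => ?_
    rw [partialDeriv_mul b (smooth_areaForm j d) (hs d b), partialDeriv_areaForm, e2]
  have h2 : ∀ d k, ∑ b, metric x b k * T x d b = T x d k := fun d k =>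
    sum_metric_mul' x (hT.tangentRight x d) k
  have h3 : ∑ d, ∑ k, leviCivita j d k * T x d k = 0 := by
    have s1 := hT.symm x 1 0
    have s2 := hT.symm x 2 0
    have s3 := hT.symm x 2 1
    simp only [leviCivita, Fin.sum_univ_three]
    fin_cases j <;> simp
    · linear_combination -s3
    · linear_combination s2
    · linear_combination -s1
  calc cartDiv (eps2 T) x j
      = ∑ d, ∑ k, leviCivita j d k * ∑ b, metric x b k * T x d b
        + ∑ d, areaForm x j d * cartDiv T x d := by
        simp only [cartDiv, h1, Fin.sum_univ_three]; ring
    _ = ∑ d, areaForm x j d * cartDiv T x d := by simp only [h2, h3, zero_add]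

/-- The contraction `C_A^B ∇^D C_DB` is invariant under duality. -/
lemma sum_eps2_mul_div2_eps2 (hS : IsSymTraceless S) (hT : IsSymTraceless T)
    (hs : SmoothTensor T) (x : S2) (i : Fin 3) :
    ∑ b, eps2 S x i b * div2 (eps2 T) x b = ∑ b, S x i b * div2 T x b := by
  rw [hT.eps2.div2_eq (smoothTensor_eps2 hs), hT.div2_eq hs]
  simp only [cartDiv_eps2 hT hs]
  exact hS.sum_eps2_mul_rotate x (hT.isOneForm_cartDiv hs x) i

/-- The quadratic terms of the evolution equation of the angular momentum aspect. -/
def angMomQuadratic (C N : S2 → Fin 3 → Fin 3 → ℝ) (x : S2) (i : Fin 3) : ℝ :=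
  1 / 4 * grad (inner2 C N) x i - 1 / 4 * div2 (fun y b a => ∑ d, C y b d * N y d a) x i
    + 1 / 2 * ∑ b, C x i b * div2 N x b

/-- Each of the three contractions contains two rotations facing each other. In the divergence term
the product tensor itself is unchanged, so no derivative of `ε` arises. -/
lemma angMomQuadratic_eps2 (hS : IsSymTraceless S) (hT : IsSymTraceless T)
    (hs : SmoothTensor T) : angMomQuadratic (eps2 S) (eps2 T) = angMomQuadratic S T := by
  have e : (fun y b a => ∑ d, eps2 S y b d * eps2 T y d a)
      = fun y b a => ∑ d, S y b d * T y d a := by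
    funext y b a
    exact hS.sum_eps2_mul_rotate y ((hT y).1 a) b
  funext x i
  simp only [angMomQuadratic, e, inner2_eps2 S hT, sum_eps2_mul_div2_eps2 hS hT hs]

lemma angMomRHS_eq {m : S2 → ℝ} (hS : IsSymTraceless S) (hs : SmoothTensor S) (x : S2)
    (i : Fin 3) : angMomRHS m S T x i
      = grad m x i - 1 / 4 * cartDivCurlDiv S x i + angMomQuadratic S T x i := by
  rw [angMomRHS, hS.div2_curl_eq hs, angMomQuadratic]; ring

lemma massRHS_eq (hT : IsSymTraceless T) (hs : SmoothTensor T) (x : S2) :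
    massRHS T x = 1 / 4 * cartDivDiv T x - 1 / 8 * inner2 T T x := by
  rw [massRHS, hT.div1_div2_eq hs]

end Duality

/-! ### Potentials -/

section Potentials
variable {f : S2 → ℝ}

lemma hess_eq (hf : Smooth f) (x : S2) (i j : Fin 3) :
    hess f x i j = partialDeriv i (partialDeriv j f) x + (x : E3) j * partialDeriv i f x := by
  have e : (fun y => grad f y j) = partialDeriv j f := funext fun y => grad_eq hf y j
  have ht : IsOneForm (grad f) := fun y => by
    simpa only [grad_eq hf] using sum_coord_mul_partialDeriv hf y
  rw [hess, covD1_eq (smoothForm_grad hf) ht, e, grad_eq hf]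

/-- The commutator of the `∂_a` is exactly offset by the term `x_j ∂_i f`. -/
lemma hess_symm (hf : Smooth f) (x : S2) (i j : Fin 3) : hess f x i j = hess f x j i := by
  rw [hess_eq hf, hess_eq hf]
  linear_combination partialDeriv_comm i j hf x

lemma sum_coord_mul_hess (hf : Smooth f) (x : S2) (j : Fin 3) :
    ∑ i, (x : E3) i * hess f x i j = 0 := by
  have h1 := sum_coord_mul_partialDeriv (smooth_partialDeriv j hf) x
  have h2 := sum_coord_mul_partialDeriv hf x
  simp only [hess_eq hf, Fin.sum_univ_three] at h1 h2 ⊢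
  linear_combination h1 + (x : E3) j * h2

lemma hess_neg (hf : Smooth f) (x : S2) (i j : Fin 3) : hess (-f) x i j = - hess f x i j := by
  have e : ∀ k, partialDeriv k (-f) = fun y => - partialDeriv k f y := fun k =>
    funext (partialDeriv_neg k hf)
  have hn : Smooth (-f) := hf.neg
  rw [hess_eq hn, hess_eq hf, e, e, partialDeriv_neg i (smooth_partialDeriv j hf)]
  ring

/-- `ε² = -σ` on tangent vectors, so rotation turns the twisted Hessian of `cb` into minus its
traceless Hessian, and the traceless Hessian of `c` into its twisted one. -/
lemma isPotentials_eps2 {T : S2 → Fin 3 → Fin 3 → ℝ} {c cb : S2 → ℝ} (h : IsPotentials T c cb) :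
    IsPotentials (eps2 T) (-cb) c := by
  obtain ⟨hc, hcb, hT⟩ := h
  refine ⟨hcb.neg, hc, fun x i j => ?_⟩
  have hl : lap (-cb) x = - lap cb x := by
    simp only [lap, hess_neg hcb, Finset.sum_neg_distrib]
  have hPe : ∑ d, areaForm x i d * metric x d j = areaForm x i j := by
    have h0 : ∑ d, (x : E3) d * areaForm x i d = 0 := by
      simp only [areaForm_antisymm x i, mul_neg, Finset.sum_neg_distrib,
        sum_coord_mul_areaForm, neg_zero]
    simpa only [mul_comm] using sum_metric_mul' x h0 j
  have hee : ∑ d, areaForm x i d * ∑ e, areaForm x d e * hess cb x e j = - hess cb x i j := by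
    rw [← sum_metric_mul x (sum_coord_mul_hess hcb x j) i]
    simp only [← sum_areaForm_mul_areaForm, areaForm_antisymm x i, Fin.sum_univ_three]
    ring
  -- `rotate_sub_rotate` moves the rotation to the other index at the cost of a trace, which
  -- supplies the `σ Δ cb` term.
  have hee2 : ∑ d, areaForm x i d * ∑ e, areaForm x j e * hess cb x e d
      = - hess cb x i j + metric x i j * lap cb x := by
    have h1 : ∀ d, ∑ e, areaForm x j e * hess cb x e d
        = ∑ e, areaForm x d e * hess cb x e j + areaForm x j d * lap cb x := fun d => by
      have := rotate_sub_rotate x (sum_coord_mul_hess hcb x) (hess_symm hcb x) j d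
      rw [lap]; linarith
    simp only [h1, mul_add, Finset.sum_add_distrib, hee]
    rw [← sum_areaForm_mul_areaForm, Finset.sum_mul]
    congr 1
    refine Finset.sum_congr rfl fun d _ => ?_
    rw [areaForm_antisymm x i d, areaForm_antisymm x j d]; ring
  -- The antisymmetric part of the rotated Hessian of `c` is `½ ε Δc`, just what the trace term
  -- subtracts; the symmetrisation remains.
  have hr : ∑ d, areaForm x i d * hess c x d j - ∑ d, areaForm x j d * hess c x d i
      = areaForm x i j * lap c x :=
    rotate_sub_rotate x (sum_coord_mul_hess hc x) (hess_symm hc x) i j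
  have hsum : eps2 T x i j = ∑ d, areaForm x i d * hess c x d j
      - 1 / 2 * lap c x * ∑ d, areaForm x i d * metric x d j
      + 1 / 2 * (∑ d, areaForm x i d * ∑ e, areaForm x d e * hess cb x e j
        + ∑ d, areaForm x i d * ∑ e, areaForm x j e * hess cb x e d) := by
    simp only [eps2, hT, Fin.sum_univ_three]; ring
  rw [hsum, hPe, hee, hee2, hess_neg hcb, hl]
  linear_combination 1 / 2 * hr

end Potentials

/-! ### Integral identities -/

section Integrals
variable {T K : S2 → Fin 3 → Fin 3 → ℝ}

/-- A 2-tensor without normal components in its first slot. -/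
def TangentLeft (T : S2 → Fin 3 → Fin 3 → ℝ) : Prop :=
  ∀ x : S2, ∀ j, ∑ i, (x : E3) i * T x i j = 0

lemma sphereIntegral_zero : sphereIntegral (fun _ => 0) = 0 := by simp [sphereIntegral]

/-- The mean curvature term `2 ∫ x·w` vanishes for tangential `w`. -/
lemma sphereIntegral_div {w : S2 → Fin 3 → ℝ} (hw : SmoothForm w) (ht : IsOneForm w) :
    sphereIntegral (fun x => ∑ a, partialDeriv a (fun y => w y a) x) = 0 := by
  rw [sphereIntegral_sum fun a => smooth_partialDeriv a (hw a)]
  simp only [sphereIntegral_partialDeriv (hw _)]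
  rw [← Finset.mul_sum, ← sphereIntegral_sum fun a => (smooth_coord a).mul (hw a)]
  have e : (fun x => ∑ a, coord a x * w x a) = fun _ => 0 := funext ht
  rw [e, sphereIntegral_zero, mul_zero]

/-- For a fixed Cartesian index `j`, the components `T_bj` form a tangential vector field. -/
lemma sphereIntegral_cartDiv (hT : SmoothTensor T) (ht : TangentLeft T) (j : Fin 3) :
    sphereIntegral (fun x => cartDiv T x j) = 0 :=
  sphereIntegral_div (w := fun x b => T x b j) (fun b => hT b j) (fun x => ht x j)

lemma sphereIntegral_mul_div {f : S2 → ℝ} {w : S2 → Fin 3 → ℝ} (hf : Smooth f)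
    (hw : SmoothForm w) (ht : IsOneForm w) :
    sphereIntegral (fun x => f x * ∑ a, partialDeriv a (fun y => w y a) x)
      = - sphereIntegral (fun x => ∑ a, partialDeriv a f x * w x a) := by
  have h := sphereIntegral_div (w := fun x a => f x * w x a) (fun a => hf.mul (hw a)) (fun x => by
    have := ht x
    simp only [Fin.sum_univ_three] at this ⊢
    linear_combination f x * this)
  have s1 : Smooth (fun x => ∑ a, partialDeriv a f x * w x a) :=
    Smooth.sum fun a => (smooth_partialDeriv a hf).mul (hw a)
  have s2 : Smooth (fun x => f x * ∑ a, partialDeriv a (fun y => w y a) x) :=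
    hf.mul (Smooth.sum fun a => smooth_partialDeriv a (hw a))
  have e : (fun x => ∑ a, partialDeriv a (fun y => f y * w y a) x)
      = fun x => (∑ a, partialDeriv a f x * w x a)
        + f x * ∑ a, partialDeriv a (fun y => w y a) x := by
    funext x
    simp only [partialDeriv_mul _ hf (hw _), Finset.sum_add_distrib, Finset.mul_sum]
  rw [e, sphereIntegral_add s1 s2] at h
  linarith

lemma sphereIntegral_cartDivDiv (hK : SmoothTensor K) (h : IsSymTraceless K) :
    sphereIntegral (cartDivDiv K) = 0 :=
  sphereIntegral_div (smoothForm_cartDiv hK) (h.isOneForm_cartDiv hK)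

/-- One integration by parts against `X^k` leaves the `k`-th Cartesian component of `div K`, itself
a divergence. -/
lemma sphereIntegral_coord_mul_cartDivDiv (hK : SmoothTensor K) (h : IsSymTraceless K)
    (k : Fin 3) : sphereIntegral (fun x => coord k x * cartDivDiv K x) = 0 := by
  have ht := h.isOneForm_cartDiv hK
  have h1 := sphereIntegral_mul_div (smooth_coord k) (smoothForm_cartDiv hK) ht
  have e : (fun x => ∑ a, partialDeriv a (coord k) x * cartDiv K x a)
      = fun x => cartDiv K x k := funext fun x => by
    simp only [partialDeriv_coord, sum_metric_mul' x (ht x)]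
  rw [e, sphereIntegral_cartDiv hK (fun x => (h x).1), neg_zero] at h1
  exact h1

lemma sphereIntegral_partialDeriv_cartDivDiv (hK : SmoothTensor K) (h : IsSymTraceless K)
    (k : Fin 3) : sphereIntegral (partialDeriv k (cartDivDiv K)) = 0 := by
  rw [sphereIntegral_partialDeriv (smooth_cartDivDiv hK),
    sphereIntegral_coord_mul_cartDivDiv hK h, mul_zero]

lemma sphereIntegral_cartDivCurlDiv (hK : SmoothTensor K) (h : IsSymTraceless K) (k : Fin 3) :
    sphereIntegral (fun x => cartDivCurlDiv K x k) = 0 :=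
  sphereIntegral_cartDiv (smoothTensor_cartCurl (smoothForm_cartDiv hK))
    (tangentLeft_cartCurl (smoothForm_cartDiv hK) (h.isOneForm_cartDiv hK)) k

/-- The pairing of a divergence with the rotation vector field `ε_ik`. -/
lemma sphereIntegral_areaForm_cartDiv (hT : SmoothTensor T) (ht : TangentLeft T) (k : Fin 3) :
    sphereIntegral (fun x => ∑ i, areaForm x i k * cartDiv T x i)
      = - sphereIntegral (fun x => ∑ i, ∑ b, leviCivita i k b * T x b i) := by
  have h1 : ∀ i, sphereIntegral (fun x => areaForm x i k * cartDiv T x i)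
      = - sphereIntegral (fun x => ∑ b, leviCivita i k b * T x b i) := fun i => by
    have := sphereIntegral_mul_div (w := fun x b => T x b i) (smooth_areaForm i k)
      (fun b => hT b i) (fun x => ht x i)
    have e : (fun x => ∑ a, partialDeriv a (fun y => areaForm y i k) x * T x a i)
        = fun x => ∑ b, leviCivita i k b * T x b i := funext fun x => by
      calc _ = ∑ b, leviCivita i k b * ∑ a, metric x a b * T x a i := by
            simp only [partialDeriv_areaForm, Fin.sum_univ_three]; ring
        _ = _ := by simp only [sum_metric_mul' x (ht x i)]
    rw [e] at this
    exact this
  rw [sphereIntegral_sum fun i => (smooth_areaForm i k).mul (smoothForm_cartDiv hT i),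
    sphereIntegral_sum fun i => Smooth.sum fun b => (smooth_const _).mul (hT b i)]
  simp only [h1, Finset.sum_neg_distrib]

/-- Rotation fields are divergence free. -/
lemma sphereIntegral_areaForm_partialDeriv {f : S2 → ℝ} (hf : Smooth f) (k : Fin 3) :
    sphereIntegral (fun x => ∑ i, areaForm x i k * partialDeriv i f x) = 0 := by
  have h := sphereIntegral_div (w := fun x i => areaForm x i k * f x)
    (fun i => (smooth_areaForm i k).mul hf) (fun x => by
      have := sum_coord_mul_areaForm x k
      simp only [Fin.sum_univ_three] at this ⊢
      linear_combination f x * this)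
  have e : (fun x => ∑ i, partialDeriv i (fun y => areaForm y i k * f y) x)
      = fun x => ∑ i, areaForm x i k * partialDeriv i f x := funext fun x => by
    have h0 : ∑ i, partialDeriv i (fun y => areaForm y i k) x = 0 := by
      simp only [partialDeriv_areaForm, leviCivita, metric, Fin.sum_univ_three]
      fin_cases k <;> simp <;> ring
    simp only [partialDeriv_mul _ (smooth_areaForm _ k) hf, Finset.sum_add_distrib,
      ← Finset.sum_mul, h0, zero_mul, zero_add]
  rwa [e] at h

/-- The Killing equation: the gradient of a rotation field is antisymmetric and pairs to zero with a
symmetric tensor. -/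
lemma sphereIntegral_areaForm_cartDiv_symTraceless (hK : SmoothTensor K)
    (h : IsSymTraceless K) (k : Fin 3) :
    sphereIntegral (fun x => ∑ i, areaForm x i k * cartDiv K x i) = 0 := by
  rw [sphereIntegral_areaForm_cartDiv hK (fun x => (h x).1)]
  have e : (fun x => ∑ i, ∑ b, leviCivita i k b * K x b i) = fun _ => 0 := funext fun x => by
    have s1 := h.symm x 1 0
    have s2 := h.symm x 2 0
    have s3 := h.symm x 2 1
    simp only [leviCivita, Fin.sum_univ_three, s1, s2, s3]
    ring
  rw [e, sphereIntegral_zero, neg_zero]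

/-- Integration by parts leaves `ε_ikb (∂_b s_i - x_b s_i)` with `s = div K`, up to a factor. As `∫
∂_b s_i = 2 ∫ x_b s_i`, everything is a multiple of the pairing of `s` with the rotation field,
which is zero. -/
lemma sphereIntegral_areaForm_cartDivCurlDiv (hK : SmoothTensor K) (h : IsSymTraceless K)
    (k : Fin 3) :
    sphereIntegral (fun x => ∑ i, areaForm x i k * cartDivCurlDiv K x i) = 0 := by
  have hs := smoothForm_cartDiv hK
  have ht := h.isOneForm_cartDiv hK
  rw [cartDivCurlDiv, sphereIntegral_areaForm_cartDiv (smoothTensor_cartCurl hs)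
    (tangentLeft_cartCurl hs ht)]
  have sD : ∀ i b, Smooth (fun x => leviCivita i k b * partialDeriv b (fun y => cartDiv K y i) x) :=
    fun i b => (smooth_const _).mul (smooth_partialDeriv b (hs i))
  have sX : ∀ i b, Smooth (fun x => leviCivita i k b * (coord b x * cartDiv K x i)) :=
    fun i b => (smooth_const _).mul ((smooth_coord b).mul (hs i))
  have e : (fun x => ∑ i, ∑ b, leviCivita i k b * cartCurl (cartDiv K) x b i)
      = fun x => 2 * ((∑ i, ∑ b, leviCivita i k b * partialDeriv b (fun y => cartDiv K y i) x)
        - ∑ i, ∑ b, leviCivita i k b * (coord b x * cartDiv K x i)) := funext fun x => by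
    simp only [cartCurl, leviCivita, Fin.sum_univ_three]
    ring
  have e2 : ∀ x, ∑ i, areaForm x i k * cartDiv K x i
      = ∑ i, ∑ b, leviCivita i k b * (coord b x * cartDiv K x i) := fun x => by
    refine Finset.sum_congr rfl fun i _ => ?_
    rw [areaForm_eq, Finset.sum_mul]
    exact Finset.sum_congr rfl fun b _ => by rw [coord]; ring
  have h0 := sphereIntegral_areaForm_cartDiv_symTraceless hK h k
  simp only [e2] at h0
  rw [e, sphereIntegral_const_mul, sphereIntegral_sub
    (Smooth.sum fun i => Smooth.sum fun b => sD i b)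
    (Smooth.sum fun i => Smooth.sum fun b => sX i b), h0]
  rw [sphereIntegral_sum fun i => Smooth.sum fun b => sX i b] at h0
  simp only [sphereIntegral_sum fun b => sX _ b, sphereIntegral_const_mul] at h0
  rw [sphereIntegral_sum fun i => Smooth.sum fun b => sD i b]
  simp only [sphereIntegral_sum fun b => sD _ b, sphereIntegral_const_mul,
    sphereIntegral_partialDeriv (hs _)]
  simp only [Fin.sum_univ_three] at h0 ⊢
  linear_combination -4 * h0

end Integrals

/-! ### The dual set of data -/

/-- A function on an interval is determined by its derivative and its initial value. -/
lemma eq_of_hasDerivWithinAt_Icc {u₁ u₂ : ℝ} {f g f' : ℝ → ℝ}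
    (hf : ∀ u ∈ Icc u₁ u₂, HasDerivWithinAt f (f' u) (Icc u₁ u₂) u)
    (hg : ∀ u ∈ Icc u₁ u₂, HasDerivWithinAt g (f' u) (Icc u₁ u₂) u)
    (h0 : f u₁ = g u₁) {u : ℝ} (hu : u ∈ Icc u₁ u₂) : f u = g u := by
  have h := (convex_Icc u₁ u₂).norm_image_sub_le_of_norm_hasDerivWithin_le (C := 0)
    (f := fun v => f v - g v) (fun v hv => (hf v hv).sub (hg v hv)) (fun v _ => by simp)
    (⟨le_rfl, hu.1.trans hu.2⟩ : u₁ ∈ Icc u₁ u₂) hu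
  rw [zero_mul, h0, sub_self, sub_zero, norm_le_zero_iff] at h
  exact sub_eq_zero.mp h

/-- The change `ε₂(T) - T` of a tensor under duality. -/
def dualityDefect (T : S2 → Fin 3 → Fin 3 → ℝ) (x : S2) (i j : Fin 3) : ℝ :=
  eps2 T x i j - T x i j

/-- The time primitive of the change of the shear. -/
def shearDefectPrimitive (u₁ : ℝ) (D : Fields) (u : ℝ) (x : S2) (i j : Fin 3) : ℝ :=
  ∫ v in u₁..u, dualityDefect (D.shear v) x i j

/-- The change of the mass aspect under duality. -/
def massShift (u₁ : ℝ) (D : Fields) (u : ℝ) (x : S2) : ℝ :=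
  -- The news is the time derivative of the shear, so this equation integrates in closed form.
  1 / 4 * (cartDivDiv (dualityDefect (D.shear u)) x
    - cartDivDiv (dualityDefect (D.shear u₁)) x)

/-- The change of the angular momentum aspect under duality. -/
def angMomShift (u₁ : ℝ) (D : Fields) (u : ℝ) (x : S2) (i : Fin 3) : ℝ :=
  -- The part of `massShift` constant in time integrates to the term linear in `u - u₁`.
  1 / 4 * (partialDeriv i (cartDivDiv (shearDefectPrimitive u₁ D u)) x
    - (u - u₁) * partialDeriv i (cartDivDiv (dualityDefect (D.shear u₁))) x
    - cartDivCurlDiv (shearDefectPrimitive u₁ D u) x i)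

/-- The dual fields. -/
def dualFields (u₁ : ℝ) (D : Fields) : Fields where
  mass u x := D.mass u x + massShift u₁ D u x
  angMom u x i := D.angMom u x i + angMomShift u₁ D u x i
  shear u := eps2 (D.shear u)
  news u := eps2 (D.news u)

lemma TimeDeriv.eps2 {u₁ u₂ : ℝ} {T T' : ℝ → S2 → Fin 3 → Fin 3 → ℝ}
    (h : ∀ i j, TimeDeriv u₁ u₂ (fun u x => T u x i j) (fun u x => T' u x i j)) (i j : Fin 3) :
    TimeDeriv u₁ u₂ (fun u x => eps2 (T u) x i j) (fun u x => eps2 (T' u) x i j) :=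
  TimeDeriv.sum fun d => (h d j).smooth_mul (smooth_areaForm i d)

section Data
variable {u₁ u₂ : ℝ} {D D' D'' : Fields}

lemma IsNullInfinityData.timeDeriv_shear (hD : IsNullInfinityData u₁ u₂ D) (i j : Fin 3) :
    TimeDeriv u₁ u₂ (fun u x => D.shear u x i j) (fun u x => D.news u x i j) :=
  ⟨smoothOn_pi.mp (smoothOn_pi.mp hD.smooth_shear i) j,
    smoothOn_pi.mp (smoothOn_pi.mp hD.smooth_news i) j,
    fun u hu x => hD.deriv_shear u hu x i j⟩

lemma IsNullInfinityData.smoothTensor_shear (hD : IsNullInfinityData u₁ u₂ D) {u : ℝ}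
    (hu : u ∈ Icc u₁ u₂) : SmoothTensor (D.shear u) := fun i j =>
  (hD.timeDeriv_shear i j).smooth.smooth hu

lemma IsNullInfinityData.smoothTensor_news (hD : IsNullInfinityData u₁ u₂ D) {u : ℝ}
    (hu : u ∈ Icc u₁ u₂) : SmoothTensor (D.news u) := fun i j =>
  (hD.timeDeriv_shear i j).smooth_deriv.smooth hu

lemma IsNullInfinityData.smooth_mass_slice (hD : IsNullInfinityData u₁ u₂ D) {u : ℝ}
    (hu : u ∈ Icc u₁ u₂) : Smooth (D.mass u) := SmoothOn.smooth hD.smooth_mass hu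

lemma IsNullInfinityData.smoothForm_angMom (hD : IsNullInfinityData u₁ u₂ D) {u : ℝ}
    (hu : u ∈ Icc u₁ u₂) : SmoothForm (D.angMom u) := fun i =>
  SmoothOn.smooth (f := fun u x => D.angMom u x i) (smoothOn_pi.mp hD.smooth_angMom i) hu

lemma IsNullInfinityData.timeDeriv_defect (hD : IsNullInfinityData u₁ u₂ D) (i j : Fin 3) :
    TimeDeriv u₁ u₂ (fun u x => dualityDefect (D.shear u) x i j)
      (fun u x => dualityDefect (D.news u) x i j) :=
  (TimeDeriv.eps2 hD.timeDeriv_shear i j).sub (hD.timeDeriv_shear i j)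

lemma IsNullInfinityData.timeDeriv_primitive (hD : IsNullInfinityData u₁ u₂ D) (h12 : u₁ < u₂)
    (i j : Fin 3) : TimeDeriv u₁ u₂ (fun u x => shearDefectPrimitive u₁ D u x i j)
      (fun u x => dualityDefect (D.shear u) x i j) :=
  timeDeriv_integral h12 (hD.timeDeriv_defect i j).smooth

lemma IsNullInfinityData.symTraceless_defect (hD : IsNullInfinityData u₁ u₂ D) {u : ℝ}
    (hu : u ∈ Icc u₁ u₂) : IsSymTraceless (dualityDefect (D.shear u)) :=
  (hD.symTraceless_shear u hu).eps2.sub (hD.symTraceless_shear u hu)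

lemma IsNullInfinityData.smoothTensor_defect (hD : IsNullInfinityData u₁ u₂ D) {u : ℝ}
    (hu : u ∈ Icc u₁ u₂) : SmoothTensor (dualityDefect (D.shear u)) := fun i j =>
  (hD.timeDeriv_defect i j).smooth.smooth hu

lemma IsNullInfinityData.smoothTensor_primitive (hD : IsNullInfinityData u₁ u₂ D)
    (h12 : u₁ < u₂) {u : ℝ} (hu : u ∈ Icc u₁ u₂) :
    SmoothTensor (shearDefectPrimitive u₁ D u) := fun i j =>
  (hD.timeDeriv_primitive h12 i j).smooth.smooth hu

lemma shearDefectPrimitive_self (u₁ : ℝ) (D : Fields) :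
    shearDefectPrimitive u₁ D u₁ = fun _ _ _ => 0 := by
  funext x i j; simp [shearDefectPrimitive]

/-- The conditions are linear with coefficients independent of time: they hold at `u₁` and for the
time derivative. -/
lemma IsNullInfinityData.symTraceless_primitive (hD : IsNullInfinityData u₁ u₂ D)
    (h12 : u₁ < u₂) {u : ℝ} (hu : u ∈ Icc u₁ u₂) :
    IsSymTraceless (shearDefectPrimitive u₁ D u) := by
  have hG := hD.timeDeriv_primitive h12
  have hz : ∀ v ∈ Icc u₁ u₂, HasDerivWithinAt (fun _ : ℝ => (0 : ℝ)) 0 (Icc u₁ u₂) v :=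
    fun v _ => hasDerivWithinAt_const _ _ _
  intro x
  refine ⟨fun j => ?_, fun i j => ?_, ?_⟩
  · refine eq_of_hasDerivWithinAt_Icc
      (f := fun v => ∑ i, (x : E3) i * shearDefectPrimitive u₁ D v x i j) (fun v hv => ?_) hz
      (by simp [shearDefectPrimitive_self]) hu
    have h := (TimeDeriv.sum fun i => (hG i j).smooth_mul (smooth_coord i)).hasDeriv v hv x
    rwa [show ∑ i, coord i x * dualityDefect (D.shear v) x i j = 0 from
      (hD.symTraceless_defect hv x).1 j] at h
  · refine eq_of_hasDerivWithinAt_Icc (f := fun v => shearDefectPrimitive u₁ D v x i j)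
      (g := fun v => shearDefectPrimitive u₁ D v x j i)
      (fun v hv => (hG i j).hasDeriv v hv x) (fun v hv => ?_)
      (by simp [shearDefectPrimitive_self]) hu
    rw [(hD.symTraceless_defect hv).symm x i j]
    exact (hG j i).hasDeriv v hv x
  · refine eq_of_hasDerivWithinAt_Icc
      (f := fun v => ∑ i, shearDefectPrimitive u₁ D v x i i) (fun v hv => ?_) hz
      (by simp [shearDefectPrimitive_self]) hu
    have h := (TimeDeriv.sum fun i => hG i i).hasDeriv v hv x
    rwa [(hD.symTraceless_defect hv x).2.2] at h

lemma IsNullInfinityData.smoothOn_massShift (hD : IsNullInfinityData u₁ u₂ D) (h12 : u₁ < u₂) :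
    SmoothOn u₁ u₂ (massShift u₁ D) :=
  ((smooth_const (1 / 4)).smoothOn u₁ u₂).mul
    ((TimeDeriv.cartDivDiv h12 hD.timeDeriv_defect).smooth.sub
      ((smooth_cartDivDiv (hD.smoothTensor_defect ⟨le_rfl, h12.le⟩)).smoothOn u₁ u₂))

lemma IsNullInfinityData.smoothOn_angMomShift (hD : IsNullInfinityData u₁ u₂ D) (h12 : u₁ < u₂)
    (i : Fin 3) : SmoothOn u₁ u₂ (fun u x => angMomShift u₁ D u x i) := by
  have hG := hD.timeDeriv_primitive h12
  have h0 := smooth_partialDeriv i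
    (smooth_cartDivDiv (hD.smoothTensor_defect (u := u₁) ⟨le_rfl, h12.le⟩))
  exact ((smooth_const (1 / 4)).smoothOn u₁ u₂).mul
    ((((TimeDeriv.cartDivDiv h12 hG).partialDeriv h12 i).smooth.sub
      (((smoothOn_time u₁ u₂).sub ((smooth_const u₁).smoothOn u₁ u₂)).mul
        (h0.smoothOn u₁ u₂))).sub (TimeDeriv.cartDivCurlDiv h12 hG i).smooth)

lemma IsNullInfinityData.isOneForm_angMomShift (hD : IsNullInfinityData u₁ u₂ D)
    (h12 : u₁ < u₂) {u : ℝ} (hu : u ∈ Icc u₁ u₂) : IsOneForm (angMomShift u₁ D u) := fun x => by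
  have hGs := hD.smoothTensor_primitive h12 hu
  have hGt := hD.symTraceless_primitive h12 hu
  have h1 := sum_coord_mul_partialDeriv (smooth_cartDivDiv hGs) x
  have h2 := sum_coord_mul_partialDeriv
    (smooth_cartDivDiv (hD.smoothTensor_defect (u := u₁) ⟨le_rfl, h12.le⟩)) x
  have h3 : ∑ i, (x : E3) i * cartDivCurlDiv (shearDefectPrimitive u₁ D u) x i = 0 := by
    have hs := smoothForm_cartDiv hGs
    rw [cartDivCurlDiv, sum_coord_mul_cartDiv (smoothTensor_cartCurl hs)
      (tangentRight_cartCurl hs (hGt.isOneForm_cartDiv hGs)), neg_eq_zero]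
    exact Finset.sum_eq_zero fun b _ => by
      have := cartCurl_antisymm (cartDiv (shearDefectPrimitive u₁ D u)) x b b; linarith
  simp only [angMomShift, Fin.sum_univ_three] at h1 h2 h3 ⊢
  linear_combination 1 / 4 * (h1 - (u - u₁) * h2 - h3)

theorem IsNullInfinityData.dualFields (hD : IsNullInfinityData u₁ u₂ D) (h12 : u₁ < u₂) :
    IsNullInfinityData u₁ u₂ (dualFields u₁ D) := by
  have h1 : u₁ ∈ Icc u₁ u₂ := ⟨le_rfl, h12.le⟩
  have hε := TimeDeriv.eps2 hD.timeDeriv_shear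
  have hG := hD.timeDeriv_primitive h12
  refine
    { smooth_mass := SmoothOn.add hD.smooth_mass (hD.smoothOn_massShift h12)
      smooth_angMom := smoothOn_pi.mpr fun i =>
        SmoothOn.add (smoothOn_pi.mp hD.smooth_angMom i) (hD.smoothOn_angMomShift h12 i)
      smooth_shear := smoothOn_pi.mpr fun i => smoothOn_pi.mpr fun j => (hε i j).smooth
      smooth_news := smoothOn_pi.mpr fun i => smoothOn_pi.mpr fun j => (hε i j).smooth_deriv
      oneForm_angMom := fun u hu x => ?_
      symTraceless_shear := fun u hu => (hD.symTraceless_shear u hu).eps2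
      symTraceless_news := fun u hu => (hD.symTraceless_news u hu).eps2
      deriv_shear := fun u hu x i j => (hε i j).hasDeriv u hu x
      deriv_mass := fun u hu x => ?_
      deriv_angMom := fun u hu x i => ?_ }
  · have e1 := hD.oneForm_angMom u hu x
    have e2 := hD.isOneForm_angMomShift h12 hu x
    simp only [NullInfinity.dualFields, Fin.sum_univ_three] at e1 e2 ⊢
    linear_combination e1 + e2
  · have hN := hD.symTraceless_news u hu
    have hNs := hD.smoothTensor_news hu
    have d1 := (hD.deriv_mass u hu x).add ((((TimeDeriv.cartDivDiv h12
      hD.timeDeriv_defect).hasDeriv u hu x).sub_const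
        (cartDivDiv (dualityDefect (D.shear u₁)) x)).const_mul (1 / 4))
    refine d1.congr_deriv ?_
    -- The added derivative is the exact change of the linear term; the quadratic one is invariant.
    have e : cartDivDiv (dualityDefect (D.news u)) x
        = cartDivDiv (eps2 (D.news u)) x - cartDivDiv (D.news u) x :=
      cartDivDiv_sub (smoothTensor_eps2 hNs) hNs x
    rw [e, massRHS_eq hN hNs, NullInfinity.dualFields, massRHS_eq hN.eps2 (smoothTensor_eps2 hNs),
      inner2_eps2 _ hN]
    ring
  · have hC := hD.symTraceless_shear u hu
    have hCs := hD.smoothTensor_shear hu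
    have hN := hD.symTraceless_news u hu
    have hNs := hD.smoothTensor_news hu
    have hm := hD.smooth_mass_slice hu
    have hdd := smooth_cartDivDiv (hD.smoothTensor_defect hu)
    have hdd1 := smooth_cartDivDiv (hD.smoothTensor_defect h1)
    have d1 := (hD.deriv_angMom u hu x i).add
      (((((TimeDeriv.cartDivDiv h12 hG).partialDeriv h12 i).hasDeriv u hu x).sub
        (((hasDerivWithinAt_id u (Icc u₁ u₂)).sub_const u₁).mul_const
          (partialDeriv i (cartDivDiv (dualityDefect (D.shear u₁))) x))).sub
        ((TimeDeriv.cartDivCurlDiv h12 hG i).hasDeriv u hu x) |>.const_mul (1 / 4))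
    refine d1.congr_deriv ?_
    have e : cartDivCurlDiv (dualityDefect (D.shear u)) x i
        = cartDivCurlDiv (eps2 (D.shear u)) x i - cartDivCurlDiv (D.shear u) x i :=
      cartDivCurlDiv_sub (smoothTensor_eps2 hCs) hCs x i
    have hms : Smooth (massShift u₁ D u) := (smooth_const (1 / 4)).mul (hdd.sub hdd1)
    -- The new mass aspect enters the equation through its gradient, which accounts for the first
    -- two terms of `angMomShift`.
    have e2 : partialDeriv i (massShift u₁ D u) x
        = 1 / 4 * (partialDeriv i (cartDivDiv (dualityDefect (D.shear u))) x
          - partialDeriv i (cartDivDiv (dualityDefect (D.shear u₁))) x) := by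
      rw [← partialDeriv_sub i hdd hdd1]
      exact partialDeriv_const_mul i (1 / 4) (hdd.sub hdd1) x
    have e3 : grad ((NullInfinity.dualFields u₁ D).mass u) x i
        = grad (D.mass u) x i + partialDeriv i (massShift u₁ D u) x := by
      rw [grad_eq hm, ← partialDeriv_add i hm hms]
      exact grad_eq (hm.add hms) x i
    have e4 : angMomRHS ((NullInfinity.dualFields u₁ D).mass u)
        ((NullInfinity.dualFields u₁ D).shear u) ((NullInfinity.dualFields u₁ D).news u) x i
        = grad ((NullInfinity.dualFields u₁ D).mass u) x i
          - 1 / 4 * cartDivCurlDiv (eps2 (D.shear u)) x i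
          + angMomQuadratic (eps2 (D.shear u)) (eps2 (D.news u)) x i :=
      angMomRHS_eq hC.eps2 (smoothTensor_eps2 hCs) x i
    rw [e4, e3, e2, e, angMomQuadratic_eps2 hC hN hNs, angMomRHS_eq hC hCs]
    ring

theorem IsNullInfinityData.isDualData (hD : IsNullInfinityData u₁ u₂ D) (h12 : u₁ < u₂) :
    IsDualData u₁ u₂ D (NullInfinity.dualFields u₁ D) where
  isData := hD.dualFields h12
  shear_eq _ _ := rfl
  mass_init := by
    funext x; simp [NullInfinity.dualFields, massShift]
  angMom_init := by
    funext x i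
    have e : cartDiv (fun _ _ _ => 0) = fun _ _ => 0 := by
      funext x j; simp [cartDiv, partialDeriv_const]
    have e2 : cartDivDiv (fun _ _ _ => 0) = fun _ => 0 := by
      funext x; simp [cartDivDiv, e, partialDeriv_const]
    have e3 : cartDivCurlDiv (fun _ _ _ => 0) x i = 0 := by
      have : cartCurl (fun _ _ => 0) = fun _ _ _ => 0 := by
        funext x i j; simp [cartCurl, partialDeriv_const]
      simp [cartDivCurlDiv, e, this]
    simp [NullInfinity.dualFields, angMomShift, shearDefectPrimitive_self, e2, e3,
      partialDeriv_const]

/-- Dual data are unique. -/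
theorem IsDualData.agreeOn (h12 : u₁ < u₂) (h' : IsDualData u₁ u₂ D D')
    (h'' : IsDualData u₁ u₂ D D'') : AgreeOn u₁ u₂ D' D'' := by
  have hshear : ∀ u ∈ Icc u₁ u₂, D''.shear u = D'.shear u := fun u hu => by
    rw [h''.shear_eq u hu, h'.shear_eq u hu]
  -- Derivatives within `[u₁, u₂]` are unique because the interval is nondegenerate.
  have hnews : ∀ u ∈ Icc u₁ u₂, D''.news u = D'.news u := fun u hu => by
    funext x i j
    refine (uniqueDiffOn_Icc h12 u hu).eq_deriv _ (h''.isData.deriv_shear u hu x i j) ?_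
    exact (h'.isData.deriv_shear u hu x i j).congr (fun v hv => by rw [hshear v hv])
      (by rw [hshear u hu])
  have hmass : ∀ u ∈ Icc u₁ u₂, D''.mass u = D'.mass u := fun u hu => by
    funext x
    refine eq_of_hasDerivWithinAt_Icc (f := fun v => D''.mass v x) (g := fun v => D'.mass v x)
      (fun v hv => h''.isData.deriv_mass v hv x) (fun v hv => ?_)
      (by rw [h''.mass_init, h'.mass_init]) hu
    rw [hnews v hv]
    exact h'.isData.deriv_mass v hv x
  refine fun u hu => ⟨hmass u hu, ?_, hshear u hu, hnews u hu⟩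
  funext x i
  refine eq_of_hasDerivWithinAt_Icc (f := fun v => D''.angMom v x i)
    (g := fun v => D'.angMom v x i)
    (fun v hv => h''.isData.deriv_angMom v hv x i) (fun v hv => ?_)
    (by rw [h''.angMom_init, h'.angMom_init]) hu
  rw [hmass v hv, hshear v hv, hnews v hv]
  exact h'.isData.deriv_angMom v hv x i

end Data

/-! ### Invariance of the conserved quantities -/

lemma grad_coord (k : Fin 3) (x : S2) (j : Fin 3) : grad (coord k) x j = metric x j k := by
  rw [grad_eq (smooth_coord k), partialDeriv_coord]

/-- Identifies the field paired in the angular momentum as the rotation field `ε_ik`. -/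
lemma sum_areaForm_mul_grad_coord (k : Fin 3) (x : S2) (i : Fin 3) :
    ∑ j, areaForm x i j * grad (coord k) x j = areaForm x i k := by
  have h0 : ∑ d, (x : E3) d * areaForm x i d = 0 := by
    simp only [areaForm_antisymm x i, mul_neg, Finset.sum_neg_distrib,
      sum_coord_mul_areaForm, neg_zero]
  simpa only [grad_coord, mul_comm] using sum_metric_mul' x h0 k

lemma sphereIntegral_eq_of_sub {f g h : S2 → ℝ} (hf : Smooth f) (hh : Smooth h)
    (e : ∀ x, g x = f x + h x) (h0 : sphereIntegral h = 0) :
    sphereIntegral g = sphereIntegral f := by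
  rw [show g = fun x => f x + h x from funext e, sphereIntegral_add hf hh, h0, add_zero]

section Charges
variable {u₁ u₂ : ℝ} {D : Fields} (hD : IsNullInfinityData u₁ u₂ D) (h12 : u₁ < u₂) {u : ℝ}
  (hu : u ∈ Icc u₁ u₂)
include hD h12 hu

lemma smooth_massShift : Smooth (massShift u₁ D u) := (hD.smoothOn_massShift h12).smooth hu

lemma smoothForm_angMomShift : SmoothForm (angMomShift u₁ D u) := fun i =>
  (hD.smoothOn_angMomShift h12 i).smooth hu

lemma sphereIntegral_massShift : sphereIntegral (massShift u₁ D u) = 0 := by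
  have h1 : u₁ ∈ Icc u₁ u₂ := ⟨le_rfl, h12.le⟩
  have a := hD.smoothTensor_defect hu
  have b := hD.smoothTensor_defect h1
  calc sphereIntegral (massShift u₁ D u)
      = 1 / 4 * (sphereIntegral (cartDivDiv (dualityDefect (D.shear u)))
          - sphereIntegral (cartDivDiv (dualityDefect (D.shear u₁)))) := by
        rw [← sphereIntegral_sub (smooth_cartDivDiv a) (smooth_cartDivDiv b),
          ← sphereIntegral_const_mul]
        rfl
    _ = 0 := by
        rw [sphereIntegral_cartDivDiv a (hD.symTraceless_defect hu),
          sphereIntegral_cartDivDiv b (hD.symTraceless_defect h1)]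
        ring

lemma sphereIntegral_coord_mul_massShift (k : Fin 3) :
    sphereIntegral (fun x => coord k x * massShift u₁ D u x) = 0 := by
  have h1 : u₁ ∈ Icc u₁ u₂ := ⟨le_rfl, h12.le⟩
  have a := hD.smoothTensor_defect hu
  have b := hD.smoothTensor_defect h1
  have hk := smooth_coord k
  calc sphereIntegral (fun x => coord k x * massShift u₁ D u x)
      = 1 / 4 * (sphereIntegral (fun x => coord k x * cartDivDiv (dualityDefect (D.shear u)) x)
          - sphereIntegral (fun x => coord k x * cartDivDiv (dualityDefect (D.shear u₁)) x)) := by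
        rw [← sphereIntegral_sub (hk.mul (smooth_cartDivDiv a)) (hk.mul (smooth_cartDivDiv b)),
          ← sphereIntegral_const_mul]
        congr 1
        funext x
        simp only [massShift]
        ring
    _ = 0 := by
        rw [sphereIntegral_coord_mul_cartDivDiv a (hD.symTraceless_defect hu),
          sphereIntegral_coord_mul_cartDivDiv b (hD.symTraceless_defect h1)]
        ring

/-- The pairing with `∇X^k` in disguise: on a tangential form, `∇X^k` picks out the `k`-th Cartesian
component. -/
lemma sphereIntegral_angMomShift (k : Fin 3) :
    sphereIntegral (fun x => angMomShift u₁ D u x k) = 0 := by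
  have h1 : u₁ ∈ Icc u₁ u₂ := ⟨le_rfl, h12.le⟩
  have a := hD.smoothTensor_primitive h12 hu
  have a' := hD.symTraceless_primitive h12 hu
  have b := hD.smoothTensor_defect h1
  have sa := smooth_partialDeriv k (smooth_cartDivDiv a)
  have sb := smooth_partialDeriv k (smooth_cartDivDiv b)
  have sb' := (smooth_const (u - u₁)).mul sb
  have sc := smoothForm_cartDivCurlDiv a k
  simp only [angMomShift]
  rw [sphereIntegral_const_mul, sphereIntegral_sub (sa.sub sb') sc, sphereIntegral_sub sa sb',
    sphereIntegral_const_mul, sphereIntegral_cartDivCurlDiv a a',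
    sphereIntegral_partialDeriv_cartDivDiv a a',
    sphereIntegral_partialDeriv_cartDivDiv b (hD.symTraceless_defect h1)]
  ring

lemma sphereIntegral_areaForm_angMomShift (k : Fin 3) :
    sphereIntegral (fun x => ∑ i, areaForm x i k * angMomShift u₁ D u x i) = 0 := by
  have h1 : u₁ ∈ Icc u₁ u₂ := ⟨le_rfl, h12.le⟩
  have a := hD.smoothTensor_primitive h12 hu
  have a' := hD.symTraceless_primitive h12 hu
  have b := hD.smoothTensor_defect h1
  have hk := fun i => smooth_areaForm i k
  have sa := Smooth.sum fun i => (hk i).mul (smooth_partialDeriv i (smooth_cartDivDiv a))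
  have sb := Smooth.sum fun i => (hk i).mul (smooth_partialDeriv i (smooth_cartDivDiv b))
  have sb' := (smooth_const (u - u₁)).mul sb
  have sc := Smooth.sum fun i => (hk i).mul (smoothForm_cartDivCurlDiv a i)
  have e : (fun x => ∑ i, areaForm x i k * angMomShift u₁ D u x i) = fun x => 1 / 4 *
      ((∑ i, areaForm x i k * partialDeriv i (cartDivDiv (shearDefectPrimitive u₁ D u)) x)
        - (u - u₁) *
          (∑ i, areaForm x i k * partialDeriv i (cartDivDiv (dualityDefect (D.shear u₁))) x)
        - ∑ i, areaForm x i k * cartDivCurlDiv (shearDefectPrimitive u₁ D u) x i) := by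
    funext x
    simp only [angMomShift, Fin.sum_univ_three]
    ring
  rw [e, sphereIntegral_const_mul, sphereIntegral_sub (sa.sub sb') sc, sphereIntegral_sub sa sb',
    sphereIntegral_const_mul, sphereIntegral_areaForm_cartDivCurlDiv a a',
    sphereIntegral_areaForm_partialDeriv (smooth_cartDivDiv a),
    sphereIntegral_areaForm_partialDeriv (smooth_cartDivDiv b)]
  ring

lemma energy_dualFields : energy (dualFields u₁ D) u = energy D u := by
  have hs := smooth_massShift hD h12 hu
  refine sphereIntegral_eq_of_sub (h := fun x => 2 * massShift u₁ D u x)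
    ((smooth_const 2).mul (hD.smooth_mass_slice hu)) ((smooth_const 2).mul hs)
    (fun x => by simp only [dualFields]; ring) ?_
  have : sphereIntegral (fun x => massShift u₁ D u x) = 0 := sphereIntegral_massShift hD h12 hu
  rw [sphereIntegral_const_mul, this, mul_zero]

lemma linearMomentum_dualFields (k : Fin 3) :
    linearMomentum (dualFields u₁ D) u k = linearMomentum D u k := by
  have hs := smooth_massShift hD h12 hu
  refine sphereIntegral_eq_of_sub (h := fun x => 2 * (coord k x * massShift u₁ D u x))
    (((smooth_const 2).mul (hD.smooth_mass_slice hu)).mul (smooth_coord k))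
    ((smooth_const 2).mul ((smooth_coord k).mul hs))
    (fun x => by simp only [dualFields]; ring) ?_
  rw [sphereIntegral_const_mul, sphereIntegral_coord_mul_massShift hD h12 hu, mul_zero]

omit h12 in
-- `C_A^D ∇^B C_DB` is invariant, so only the change of `N_A` remains.
lemma correctedAspect_dualFields (x : S2) (i : Fin 3) :
    correctedAspect (dualFields u₁ D) u x i
      = correctedAspect D u x i + angMomShift u₁ D u x i := by
  have hC := hD.symTraceless_shear u hu
  have e := sum_eps2_mul_div2_eps2 hC hC (hD.smoothTensor_shear hu) x i
  simp only [← hC.sum_covD2_eq, ← hC.eps2.sum_covD2_eq] at e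
  simp only [correctedAspect, dualFields, e]
  ring

omit h12 in
lemma smoothForm_correctedAspect : SmoothForm (correctedAspect D u) := fun i => by
  have hC := hD.symTraceless_shear u hu
  have hCs := hD.smoothTensor_shear hu
  simp only [correctedAspect, hC.sum_covD2_eq, hC.div2_eq hCs]
  exact (hD.smoothForm_angMom hu i).sub ((smooth_const (1 / 4)).mul
    (Smooth.sum fun d => (hCs i d).mul (smoothForm_cartDiv hCs d)))

lemma angularMomentum_dualFields (k : Fin 3) :
    angularMomentum (dualFields u₁ D) u k = angularMomentum D u k := by
  have hA := smoothForm_correctedAspect hD hu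
  have hs := smoothForm_angMomShift hD h12 hu
  simp only [angularMomentum, sum_areaForm_mul_grad_coord]
  refine sphereIntegral_eq_of_sub (Smooth.sum fun i => (smooth_areaForm i k).mul (hA i))
    (Smooth.sum fun i => (smooth_areaForm i k).mul (hs i)) (fun x => ?_)
    (sphereIntegral_areaForm_angMomShift hD h12 hu k)
  simp only [correctedAspect_dualFields hD hu, mul_add, Finset.sum_add_distrib]

lemma centerOfMass_dualFields (k : Fin 3) :
    centerOfMass (dualFields u₁ D) u k = centerOfMass D u k := by
  have hA := smoothForm_correctedAspect hD hu
  have hs := smoothForm_angMomShift hD h12 hu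
  have hm := hD.smooth_mass_slice hu
  have hms := smooth_massShift hD h12 hu
  have hC := hD.symTraceless_shear u hu
  have hCs := hD.smoothTensor_shear hu
  have hg : ∀ i, Smooth (fun x => grad (coord k) x i) := smoothForm_grad (smooth_coord k)
  have hi : Smooth (inner2 (D.shear u) (D.shear u)) :=
    Smooth.sum fun i => Smooth.sum fun j => (hCs i j).mul (hCs i j)
  have hW : SmoothForm (fun x i => correctedAspect D u x i - u * grad (D.mass u) x i
      - 1 / 16 * grad (inner2 (D.shear u) (D.shear u)) x i) := fun i =>
    ((hA i).sub ((smooth_const u).mul (smoothForm_grad hm i))).sub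
      ((smooth_const (1 / 16)).mul (smoothForm_grad hi i))
  have hgm : ∀ x i, grad ((dualFields u₁ D).mass u) x i
      = grad (D.mass u) x i + partialDeriv i (massShift u₁ D u) x := fun x i => by
    rw [grad_eq hm, ← partialDeriv_add i hm hms]
    exact grad_eq (hm.add hms) x i
  have hin : inner2 ((dualFields u₁ D).shear u) ((dualFields u₁ D).shear u)
      = inner2 (D.shear u) (D.shear u) := inner2_eps2 _ hC
  have hs1 := (smooth_const u).mul (smooth_partialDeriv k hms)
  refine sphereIntegral_eq_of_sub
    -- `C_DE C^DE` is invariant; the explicit `u` multiplies `∫ ∂_k massShift = 2 ∫ X^k massShift =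
    -- 0`.
    (h := fun x => angMomShift u₁ D u x k - u * partialDeriv k (massShift u₁ D u) x)
    (Smooth.sum fun i => (hg i).mul (hW i)) ((hs k).sub hs1) (fun x => ?_) ?_
  · have e1 := sum_metric_mul' x (hD.isOneForm_angMomShift h12 hu x) k
    have e2 := sum_metric_mul' x (sum_coord_mul_partialDeriv hms x) k
    simp only [correctedAspect_dualFields hD hu, hgm, hin, grad_coord]
    simp only [Fin.sum_univ_three] at e1 e2 ⊢
    linear_combination e1 - u * e2
  · rw [sphereIntegral_sub (hs k) hs1, sphereIntegral_const_mul, sphereIntegral_partialDeriv hms,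
      sphereIntegral_coord_mul_massShift hD h12 hu, sphereIntegral_angMomShift hD h12 hu]
    ring

end Charges

end NullInfinity

end

/-- Every set of null infinity data `D` on `[u₁, u₂] × S²` has a dual set of data, unique on
`[u₁, u₂] × S²`; its news is `ε₂` of the news, potentials `(c, cb)` and `(n, nb)` are replaced by
`(-cb, c)` and `(-nb, n)`, and it has the same classical energy, linear momentum, angular momentum
and center of mass at every retarded time. -/
theorem mainTheorem8 (u₁ u₂ : ℝ) (hu : u₁ < u₂) (D : NullInfinity.Fields)
    (hD : NullInfinity.IsNullInfinityData u₁ u₂ D) :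
    ∃ D' : NullInfinity.Fields,
      NullInfinity.IsDualData u₁ u₂ D D' ∧
      (∀ D'' : NullInfinity.Fields, NullInfinity.IsDualData u₁ u₂ D D'' →
        NullInfinity.AgreeOn u₁ u₂ D' D'') ∧
      (∀ u ∈ Set.Icc u₁ u₂,
        D'.news u = NullInfinity.eps2 (D.news u) ∧
        (∀ c cb : NullInfinity.S2 → ℝ, NullInfinity.IsPotentials (D.shear u) c cb →
          NullInfinity.IsPotentials (D'.shear u) (-cb) c) ∧
        (∀ n nb : NullInfinity.S2 → ℝ, NullInfinity.IsPotentials (D.news u) n nb →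
          NullInfinity.IsPotentials (D'.news u) (-nb) n)) ∧
      (∀ u ∈ Set.Icc u₁ u₂,
        NullInfinity.energy D' u = NullInfinity.energy D u ∧
        ∀ k : Fin 3,
          NullInfinity.linearMomentum D' u k = NullInfinity.linearMomentum D u k ∧
          NullInfinity.angularMomentum D' u k = NullInfinity.angularMomentum D u k ∧
          NullInfinity.centerOfMass D' u k = NullInfinity.centerOfMass D u k) := by
  refine ⟨NullInfinity.dualFields u₁ D, hD.isDualData hu, fun D'' h'' =>
    (hD.isDualData hu).agreeOn hu h'', fun u _ => ⟨rfl, fun c cb h =>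
      NullInfinity.isPotentials_eps2 h, fun n nb h => NullInfinity.isPotentials_eps2 h⟩,
    fun u h => ⟨NullInfinity.energy_dualFields hD hu h, fun k =>
      ⟨NullInfinity.linearMomentum_dualFields hD hu h k,
        NullInfinity.angularMomentum_dualFields hD hu h k,
        NullInfinity.centerOfMass_dualFields hD hu h k⟩⟩⟩
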